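/- Let $Y\subseteq\mathbb R^{d'}$ be closed and convex and let $f:\mathbb R^d\times Y\to\mathbb R$ be differentiable in each variable. Write $P(x)=\max_{y\in Y}f(x,y)$ and $\mathrm{Gap}(x,y)=P(x)-\min_{x'\in\mathbb R^d}f(x',y)$. Let $\ell,\mu,\mu_x,\mu_y,\rho,\sigma,\varepsilon>0$, $\epsilon_0\ge 0$ and $L\in\mathbb R$. A differentiable function $h:\mathbb R^d\to\mathbb R$ satisfies the $\lambda$-PL condition if it has a global minimum point $x_*$ and $\|\nabla h(x)\|^2\ge 2\lambda(h(x)-h(x_*))$ for all $x$. Assume: - $F=(\nabla_xf,-\nabla_yf)$ is $\ell$-Lipschitz on $\mathbb R^d\times Y$ for the Euclidean norm, and $f(x,\cdot)$ is $\mu_y$-strongly concave on $Y$ for every $x$; - $P$ is differentiable with $L$-Lipschitz gradient and satisfies the $\mu$-PL condition; - for every $y\in Y$, $f(\cdot,y)$ satisfies the $\mu_x$-PL condition and is $\rho$-weakly convex, i.e. $f(x,y)\ge f(x',y)+\langle\nabla_xf(x',y),x-x'\rangle-\frac\rho2\|x-x'\|^2$ for all $x,x'$, where $\rho\le\ell$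 and $\rho\le\mu/8$; - $x_0\in\mathbb R^d$ and $y_0\in Y$ satisfy $\mathrm{Gap}(x_0,y_0)\le\epsilon_0$; - the samples $\xi^k_t$ $(k,t\in\mathbb N)$ are independent, and for every $k,t$ and every $(x,y)\in\mathbb R^d\times Y$ the stochastic gradients $G_x(x,y;\xi^k_t)$, $G_y(x,y;\xi^k_t)$ have means $\nabla_xf(x,y)$, $\nabla_yf(x,y)$ and satisfy $\mathbb E\|G_x-\nabla_xf\|^2\le\sigma^2$, $\mathbb E\|G_y-\nabla_yf\|^2\le\sigma^2$. Method. Put $\gamma=\min\{\mu/4,\,2\ell\}$ and, for $\eta_0>0$ and $k\ge1$, $\eta_k=\eta_0e^{-(k-1)/16}$ and $T_k=\Big\lceil\frac{384}{\eta_0\min\{\mu/8,\mu_y\}}e^{(k-1)/16}\Big\rceil$. For $k=1,2,\dots$, epoch $k$ computes $(x_k,y_k)$ from $(x_{k-1},y_{k-1})$ by $T_k$ steps of stochastic optimistic gradient descent ascent on $f(x,y)+\frac\gamma2\|x-x_{k-1}\|^2$: with $\mathcal G(z;\xi)=\big(G_x(x,y;\xi)+\gamma(x-x_{k-1}),\,-G_y(x,y;\xi)\big)$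 for $z=(x,y)$, and $\Pi_{\bar z}(g)=\arg\min_{z\in\mathbb R^d\times Y}g^\top z+\frac12\|z-\bar z\|^2$, start from $z_0=\tilde z_0=(x_{k-1},y_{k-1})$, set $z_t=\Pi_{\tilde z_{t-1}}(\eta_k\mathcal G(z_{t-1};\xi^k_{t-1}))$ and $\tilde z_t=\Pi_{\tilde z_{t-1}}(\eta_k\mathcal G(z_t;\xi^k_t))$ for $t=1,\dots,T_k$, and output $(x_k,y_k)=\frac1{T_k}\sum_{t=1}^{T_k}z_t$. Then there are universal constants $c\in(0,\frac1{2\sqrt2}]$, $C$ and $p\in\mathbb N$ such that, with $\eta_0=c/\ell$ (so that $\eta_k\le\frac1{2\sqrt2\,\ell}$ for all $k\ge1$), there is a number of epochs $K\ge0$ depending only on $\ell,\mu,\mu_x,\mu_y,\epsilon_0,\sigma,\varepsilon$ for which $\mathrm{Gap}(x_K,y_K)$ is integrable, $\mathbb E[\mathrm{Gap}(x_K,y_K)]\le\varepsilon$, and the total number of iterations is $$\sum_{k=1}^KT_k\;\le\;C\,R\,\log^p(2+R),\qquad R=\Big(\frac{\mu}{\mu_x}+1\Big)\frac{\max\{\ell\epsilon_0,\sigma^2\}}{\min\{\mu,\mu_y\}\,\varepsilon},$$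 that is, $\widetilde O(R)$. -/

import Mathlib

open MeasureTheory ProbabilityTheory

noncomputable section

namespace PES

/-- `ℝⁿ` with the Euclidean norm. -/
abbrev Vec (n : ℕ) : Type := EuclideanSpace ℝ (Fin n)

/-- Points `z = (x, y)`. The Euclidean structure `‖z‖² = ‖x‖² + ‖y‖²` is always written out in
components, so the sup norm of the product type is never used. -/
abbrev Pt (d d' : ℕ) : Type := Vec d × Vec d'

variable {d d' : ℕ} {Ξ : Type*}

/-! ### Primal function, duality gap, regularity conditions -/

/-- The primal function `P(x) = max_{y ∈ Y} f(x, y)`. -/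
def primal (Y : Set (Vec d')) (f : Vec d → Vec d' → ℝ) (x : Vec d) : ℝ :=
  sSup ((fun y => f x y) '' Y)

/-- The dual function `min_{x ∈ ℝᵈ} f(x, y)`. -/
def dual (f : Vec d → Vec d' → ℝ) (y : Vec d') : ℝ :=
  sInf (Set.range fun x => f x y)

/-- The duality gap `Gap(x, y) = max_{y' ∈ Y} f(x, y') - min_{x'} f(x', y)`. -/
def gap (Y : Set (Vec d')) (f : Vec d → Vec d' → ℝ) (z : Pt d d') : ℝ :=
  primal Y f z.1 - dual f z.2

/-- `h` is `L`-smooth: it is differentiable with `L`-Lipschitz gradient. -/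
def IsSmooth (L : ℝ) (h : Vec d → ℝ) : Prop :=
  Differentiable ℝ h ∧ ∀ x x', ‖gradient h x - gradient h x'‖ ≤ L * ‖x - x'‖

/-- The `μ`-PL condition for `h` with gradient `g`: `h` has a global minimum point `x_*` and
`‖g(x)‖² ≥ 2 μ (h(x) - h(x_*))` for all `x`. -/
def IsPL (μ : ℝ) (h : Vec d → ℝ) (g : Vec d → Vec d) : Prop :=
  ∃ xs, (∀ x, h xs ≤ h x) ∧ ∀ x, 2 * μ * (h x - h xs) ≤ ‖g x‖ ^ 2

/-- `h` with gradient `g` is `ρ`-weakly convex. -/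
def IsWeaklyConvex (ρ : ℝ) (h : Vec d → ℝ) (g : Vec d → Vec d) : Prop :=
  ∀ x x', inner ℝ (g x') (x - x') - ρ / 2 * ‖x - x'‖ ^ 2 ≤ h x - h x'

/-- `gx = ∇ₓ f` and `gy = ∇_y f` on `ℝᵈ × Y`, where the derivative in `y` is taken along `Y`. -/
def IsPartialGradients (Y : Set (Vec d')) (f : Vec d → Vec d' → ℝ)
    (gx : Vec d → Vec d' → Vec d) (gy : Vec d → Vec d' → Vec d') : Prop :=
  ∀ x, ∀ y ∈ Y, HasGradientAt (fun x' => f x' y) (gx x y) x ∧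
    HasGradientWithinAt (fun y' => f x y') (gy x y) Y y

/-- `F(z) = (∇ₓ f(z), -∇_y f(z))` is `ℓ`-Lipschitz on `ℝᵈ × Y` for the Euclidean norm. -/
def IsLipschitzField (ℓ : ℝ) (Y : Set (Vec d'))
    (gx : Vec d → Vec d' → Vec d) (gy : Vec d → Vec d' → Vec d') : Prop :=
  ∀ x x', ∀ y ∈ Y, ∀ y' ∈ Y,
    ‖gx x y - gx x' y'‖ ^ 2 + ‖gy x y - gy x' y'‖ ^ 2 ≤ ℓ ^ 2 * (‖x - x'‖ ^ 2 + ‖y - y'‖ ^ 2)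

/-- When the sample `s` is drawn as `ξ` under `Pr`, the random vector `G s` has mean `g` and
`E ‖G(ξ) - g‖² ≤ σ²`. -/
def IsUnbiasedWithVariance {Ω : Type*} [MeasurableSpace Ω] (Pr : Measure Ω) (ξ : Ω → Ξ) {n : ℕ}
    (G : Ξ → Vec n) (g : Vec n) (σ : ℝ) : Prop :=
  Integrable (fun ω => G (ξ ω)) Pr ∧ ∫ ω, G (ξ ω) ∂Pr = g ∧
    Integrable (fun ω => ‖G (ξ ω) - g‖ ^ 2) Pr ∧ ∫ ω, ‖G (ξ ω) - g‖ ^ 2 ∂Pr ≤ σ ^ 2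

/-! ### The algorithm -/

/-- `Π_{z̄}(g) = argmin_{z ∈ ℝᵈ × Y} gᵀ z + ‖z - z̄‖² / 2`. -/
def prox (Y : Set (Vec d')) (zbar g : Pt d d') : Pt d d' :=
  Classical.epsilon fun z : Pt d d' => z.2 ∈ Y ∧
    IsMinOn (fun w : Pt d d' => inner ℝ g.1 w.1 + inner ℝ g.2 w.2
      + (‖w.1 - zbar.1‖ ^ 2 + ‖w.2 - zbar.2‖ ^ 2) / 2) {w | w.2 ∈ Y} z

/-- The pair `(z_t, z̃_t)` of the stochastic OGDA iteration with stochastic field `G`, step size `η`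
and samples `s₀, s₁, …`: `z₀ = z̃₀` is the starting point and
`z_t = Π_{z̃_{t-1}}(η G(z_{t-1}; s_{t-1}))`, `z̃_t = Π_{z̃_{t-1}}(η G(z_t; s_t))`. -/
def ogda (Y : Set (Vec d')) (G : Pt d d' → Ξ → Pt d d') (η : ℝ) (s : ℕ → Ξ) (z₀ : Pt d d') :
    ℕ → Pt d d' × Pt d d'
  | 0 => (z₀, z₀)
  | t + 1 =>
    let prev := ogda Y G η s z₀ t
    let z := prox Y prev.2 (η • G prev.1 (s t))
    (z, prox Y prev.2 (η • G z (s (t + 1))))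

/-- The output `(1/T) ∑_{t=1}^T z_t` of `T` OGDA iterations. -/
def ogdaAverage (Y : Set (Vec d')) (G : Pt d d' → Ξ → Pt d d') (η : ℝ) (T : ℕ) (s : ℕ → Ξ)
    (z₀ : Pt d d') : Pt d d' :=
  (1 / (T : ℝ)) • ∑ t ∈ Finset.Icc 1 T, (ogda Y G η s z₀ t).1

/-- The stochastic field `(∇ₓ f_k(z; s), -∇_y f_k(z; s))` of the regularized function
`f_k(x, y) = f(x, y) + (γ/2) ‖x - x₀‖²`. -/
def regField (Gx : Vec d → Vec d' → Ξ → Vec d) (Gy : Vec d → Vec d' → Ξ → Vec d') (γ : ℝ)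
    (x₀ : Vec d) (z : Pt d d') (s : Ξ) : Pt d d' :=
  (Gx z.1 z.2 s + γ • (z.1 - x₀), -Gy z.1 z.2 s)

/-- The proximal epoch stochastic method: `(x_k, y_k)` after `k` epochs. Epoch `k ≥ 1` runs
`T k` OGDA iterations with step size `η k` and samples `s k 0, s k 1, …` on
`f + (γ/2) ‖x - x_{k-1}‖²`, starting from `(x_{k-1}, y_{k-1})`. -/
def pes (Y : Set (Vec d')) (Gx : Vec d → Vec d' → Ξ → Vec d) (Gy : Vec d → Vec d' → Ξ → Vec d')
    (γ : ℝ) (η : ℕ → ℝ) (T : ℕ → ℕ) (s : ℕ → ℕ → Ξ) (z₀ : Pt d d') : ℕ → Pt d d'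
  | 0 => z₀
  | k + 1 =>
    let z := pes Y Gx Gy γ η T s z₀ k
    ogdaAverage Y (regField Gx Gy γ z.1) (η (k + 1)) (T (k + 1)) (s (k + 1)) z

/-- `η_k = η₀ exp(-(k-1)/16)`. -/
def stepSize (η₀ : ℝ) (k : ℕ) : ℝ := η₀ * Real.exp (-((k : ℝ) - 1) / 16)

/-- `T_k = 384 / (η₀ min{μ/8, μ_y}) · exp((k-1)/16)`, rounded up. -/
def epochLength (η₀ μ μy : ℝ) (k : ℕ) : ℕ :=
  ⌈384 / (η₀ * min (μ / 8) μy) * Real.exp (((k : ℝ) - 1) / 16)⌉₊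

/-- `(μ/μₓ + 1) · max{ℓ ε₀, σ²} / (min{μ, μ_y} ε)`. -/
def rate (ℓ μ μx μy ε₀ σ ε : ℝ) : ℝ :=
  (μ / μx + 1) * (max (ℓ * ε₀) (σ ^ 2) / (min μ μy * ε))

end PES

end

/-! Each epoch is an inexact proximal point step. Because `γ ≥ 2ρ`, the game `f + (γ/2)‖x - b‖²` is
strongly convex in `x` and strongly concave in `y`. The regularized gap of the averaged iterate is
attained at its pair of best responses, and the optimistic regret bound `ogda_regret` applies to
that pair. The pair depends on the noise, so the noise term is split at the starting point: one half
is a sum of centered terms, the other is bounded by Young's inequality and the orthogonality of the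
errors. The distance from the start to the best responses is controlled, through the saddle point,
by the regularized gaps themselves (`exists_best_response`). As `λ η_k T_k ≥ 384` with `λ = min
(μ/8) μy`, an epoch turns a regularized gap `g` into at most `g/150 + 17 η_k σ²` in expectation
(`epoch_expectation`).

Between epochs, the PL condition on `P` makes the inexact proximal step contract `P - min P`
(`primal_contraction`), and moving the center to the new point costs a multiple of the gap just
obtained and of the old `P - min P` (`proxGap_recenter`). A weighted sum of both quantities
therefore shrinks by `9/10` per epoch up to noise of order `η_k σ²` (`potential_epoch`). Since `η_k`
decays at the slower rate `e^{-1/16}`, so does the bound on the potential.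

Finally the PL condition in `x` converts the regularized gap centered at its own point into the true
gap, at the price of a factor of order `μ/μx + 1` (`gap_le_proxGap`). The accuracy improves like
`e^{-k/16}` while the epoch lengths grow like `e^{k/16}`; the geometric sum is dominated by its end,
so the total is `O(R)` with no logarithm. -/

namespace PES

/-! ### Euclidean projection and the proximal map -/

section Projection

variable {E : Type*} [NormedAddCommGroup E] [InnerProductSpace ℝ E]

/-- A point `p` of `Y` satisfying the variational inequality of the projection of `u` onto `Y`. -/
def IsProj (Y : Set E) (u p : E) : Prop :=
  p ∈ Y ∧ ∀ w ∈ Y, inner ℝ (u - p) (w - p) ≤ 0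

/-- The projection onto a nonempty closed convex set. -/
noncomputable def proj (Y : Set E) (u : E) : E :=
  Classical.epsilon (IsProj Y u)

theorem isProj_proj [CompleteSpace E] {Y : Set E} (hc : IsClosed Y) (hconv : Convex ℝ Y)
    (hne : Y.Nonempty) (u : E) : IsProj Y u (proj Y u) := by
  refine Classical.epsilon_spec (p := IsProj Y u) ?_
  obtain ⟨p, hp, h⟩ := exists_norm_eq_iInf_of_complete_convex hne hc.isComplete hconv u
  exact ⟨p, hp, (norm_eq_iInf_iff_real_inner_le_zero hconv hp).1 h⟩

theorem IsProj.norm_sub_le {Y : Set E} {u v p q : E} (hp : IsProj Y u p) (hq : IsProj Y v q) :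
    ‖p - q‖ ≤ ‖u - v‖ := by
  have h1 := hp.2 q hq.1
  have h2 := hq.2 p hp.1
  have h3 : inner ℝ (u - p) (q - p) + inner ℝ (v - q) (p - q)
      = ‖p - q‖ ^ 2 - inner ℝ (u - v) (p - q) := by
    rw [← real_inner_self_eq_norm_sq, ← inner_sub_left,
      show q - p = -(p - q) by abel, inner_neg_right, neg_add_eq_sub, ← inner_sub_left]
    congr 1; abel
  have h4 := real_inner_le_norm (u - v) (p - q)
  by_contra! h
  have := norm_nonneg (u - v)
  nlinarith

theorem continuous_proj [CompleteSpace E] {Y : Set E} (hc : IsClosed Y) (hconv : Convex ℝ Y)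
    (hne : Y.Nonempty) : Continuous (proj Y) := by
  refine (LipschitzWith.of_dist_le_mul (K := 1) fun u v => ?_).continuous
  simpa [dist_eq_norm] using
    (isProj_proj hc hconv hne u).norm_sub_le (isProj_proj hc hconv hne v)

theorem proj_eq_self [CompleteSpace E] {Y : Set E} (hc : IsClosed Y) (hconv : Convex ℝ Y)
    {u : E} (hu : u ∈ Y) : proj Y u = u := by
  have h : IsProj Y u u := ⟨hu, by simp⟩
  simpa [sub_eq_zero] using (isProj_proj hc hconv ⟨u, hu⟩ u).norm_sub_le h

/-- The quadratic growth of a proximal objective at its constrained minimizer. -/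
theorem IsProj.prox_growth {Y : Set E} {b g p w : E} (hp : IsProj Y (b - g) p) (hw : w ∈ Y) :
    inner ℝ g p + ‖p - b‖ ^ 2 / 2 + ‖w - p‖ ^ 2 / 2 ≤ inner ℝ g w + ‖w - b‖ ^ 2 / 2 := by
  have h := hp.2 w hw
  have e1 : ‖w - b‖ ^ 2 = ‖w - p‖ ^ 2 + 2 * inner ℝ (w - p) (p - b) + ‖p - b‖ ^ 2 := by
    rw [← norm_add_sq_real]; congr 2; abel
  have e2 : inner ℝ (b - g - p) (w - p)
      = -inner ℝ (w - p) (p - b) - (inner ℝ g w - inner ℝ g p) := by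
    rw [real_inner_comm (p - b) (w - p), ← inner_sub_right, ← inner_neg_left, ← inner_sub_left]
    congr 1; abel
  linarith

/-- One optimistic step: regret of the extrapolated point against any `w ∈ Y`. -/
theorem IsProj.optimistic_step {Y : Set E} {b u u' z zt w : E} (hz : IsProj Y (b - u') z)
    (hzt : IsProj Y (b - u) zt) (hw : w ∈ Y) :
    inner ℝ u (z - w) ≤ ‖w - b‖ ^ 2 / 2 - ‖w - zt‖ ^ 2 / 2 - ‖zt - z‖ ^ 2 / 4
      - ‖z - b‖ ^ 2 / 2 + ‖u - u'‖ ^ 2 := by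
  have h1 := hzt.prox_growth hw
  have h2 := hz.prox_growth hzt.1
  -- Young's inequality spends only half of the growth term `‖zt - z‖²/2`; the remaining quarter
  -- pays for the Lipschitz error of the following step.
  have h3 : inner ℝ (u - u') (z - zt) ≤ ‖u - u'‖ ^ 2 + ‖zt - z‖ ^ 2 / 4 := by
    have := real_inner_le_norm (u - u') (z - zt)
    rw [norm_sub_rev z zt] at this
    nlinarith [sq_nonneg (‖u - u'‖ - ‖zt - z‖ / 2)]
  simp only [inner_sub_left, inner_sub_right] at h3 ⊢
  linarith

end Projection

variable {d d' : ℕ} {Ξ : Type*}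

theorem isProj_univ {E : Type*} [NormedAddCommGroup E] [InnerProductSpace ℝ E] (u : E) :
    IsProj Set.univ u u := ⟨trivial, by simp⟩

/-- The objective separates: the `x` part is unconstrained, so its projection is the identity.
Quadratic growth at this point makes the minimizer unique, which identifies the value picked by
`Classical.epsilon`. -/
theorem prox_eq {Y : Set (Vec d')} (hc : IsClosed Y) (hconv : Convex ℝ Y) (hne : Y.Nonempty)
    (b g : Pt d d') : prox Y b g = (b.1 - g.1, proj Y (b.2 - g.2)) := by
  set p : Pt d d' := (b.1 - g.1, proj Y (b.2 - g.2)) with hp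
  have hp2 : IsProj Y (b.2 - g.2) p.2 := isProj_proj hc hconv hne _
  have growth : ∀ w : Pt d d', w.2 ∈ Y →
      inner ℝ g.1 p.1 + inner ℝ g.2 p.2 + (‖p.1 - b.1‖ ^ 2 + ‖p.2 - b.2‖ ^ 2) / 2
        + (‖w.1 - p.1‖ ^ 2 / 2 + ‖w.2 - p.2‖ ^ 2 / 2)
      ≤ inner ℝ g.1 w.1 + inner ℝ g.2 w.2 + (‖w.1 - b.1‖ ^ 2 + ‖w.2 - b.2‖ ^ 2) / 2 := by
    intro w hw
    have h1 := (isProj_univ (b.1 - g.1)).prox_growth (Set.mem_univ w.1)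
    have h2 := hp2.prox_growth hw
    change inner ℝ g.1 p.1 + ‖p.1 - b.1‖ ^ 2 / 2 + ‖w.1 - p.1‖ ^ 2 / 2 ≤ _ at h1
    linarith
  have ex : ∃ z : Pt d d', z.2 ∈ Y ∧ IsMinOn (fun w : Pt d d' => inner ℝ g.1 w.1 + inner ℝ g.2 w.2
      + (‖w.1 - b.1‖ ^ 2 + ‖w.2 - b.2‖ ^ 2) / 2) {w | w.2 ∈ Y} z := by
    refine ⟨p, hp2.1, fun w hw => ?_⟩
    have := growth w hw
    simp only [Set.mem_ofPred_eq]
    linarith [sq_nonneg ‖w.1 - p.1‖, sq_nonneg ‖w.2 - p.2‖]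
  obtain ⟨hz, hmin⟩ := Classical.epsilon_spec ex
  change (prox Y b g).2 ∈ Y at hz
  have h1 := growth _ hz
  have h2 := isMinOn_iff.1 hmin p hp2.1
  change inner ℝ g.1 (prox Y b g).1 + inner ℝ g.2 (prox Y b g).2
    + (‖(prox Y b g).1 - b.1‖ ^ 2 + ‖(prox Y b g).2 - b.2‖ ^ 2) / 2 ≤ _ at h2
  have h3 : ‖(prox Y b g).1 - p.1‖ ^ 2 = 0 := by
    linarith [sq_nonneg ‖(prox Y b g).1 - p.1‖, sq_nonneg ‖(prox Y b g).2 - p.2‖]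
  have h4 : ‖(prox Y b g).2 - p.2‖ ^ 2 = 0 := by
    linarith [sq_nonneg ‖(prox Y b g).1 - p.1‖, sq_nonneg ‖(prox Y b g).2 - p.2‖]
  ext1
  · simpa [sub_eq_zero] using h3
  · simpa [sub_eq_zero] using h4

/-! ### Pathwise regret of optimistic gradient descent ascent -/

/-- The squared Euclidean norm of `z = (x, y)`. -/
noncomputable def sqNorm (z : Pt d d') : ℝ := ‖z.1‖ ^ 2 + ‖z.2‖ ^ 2

/-- The Euclidean inner product on pairs. -/
noncomputable def dot (z w : Pt d d') : ℝ := inner ℝ z.1 w.1 + inner ℝ z.2 w.2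

theorem sqNorm_nonneg (z : Pt d d') : 0 ≤ sqNorm z := by unfold sqNorm; positivity

theorem norm_add_sq_le_two {E : Type*} [NormedAddCommGroup E] (a b : E) :
    ‖a + b‖ ^ 2 ≤ 2 * (‖a‖ ^ 2 + ‖b‖ ^ 2) := by
  have h := norm_add_le a b
  nlinarith [norm_nonneg (a + b), norm_nonneg a, norm_nonneg b, sq_nonneg (‖a‖ - ‖b‖)]

theorem norm_add_sq_le_three {E : Type*} [NormedAddCommGroup E] (a b c : E) :
    ‖a + b + c‖ ^ 2 ≤ 3 * (‖a‖ ^ 2 + ‖b‖ ^ 2 + ‖c‖ ^ 2) := by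
  have h := norm_add₃_le (a := a) (b := b) (c := c)
  have h0 := norm_nonneg (a + b + c)
  nlinarith [sq_nonneg (‖a‖ - ‖b‖), sq_nonneg (‖a‖ - ‖c‖), sq_nonneg (‖b‖ - ‖c‖)]

theorem sqNorm_add_le_two (a b : Pt d d') : sqNorm (a + b) ≤ 2 * (sqNorm a + sqNorm b) := by
  have h1 := norm_add_sq_le_two a.1 b.1
  have h2 := norm_add_sq_le_two a.2 b.2
  simp only [sqNorm, Prod.fst_add, Prod.snd_add]
  linarith

theorem sqNorm_add_le_three (a b c : Pt d d') :
    sqNorm (a + b + c) ≤ 3 * (sqNorm a + sqNorm b + sqNorm c) := by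
  have h1 := norm_add_sq_le_three a.1 b.1 c.1
  have h2 := norm_add_sq_le_three a.2 b.2 c.2
  simp only [sqNorm, Prod.fst_add, Prod.snd_add]
  linarith

theorem sqNorm_smul (c : ℝ) (a : Pt d d') : sqNorm (c • a) = c ^ 2 * sqNorm a := by
  simp only [sqNorm, Prod.smul_fst, Prod.smul_snd, norm_smul, mul_pow, Real.norm_eq_abs, sq_abs]
  ring

theorem dot_smul_left (c : ℝ) (a b : Pt d d') : dot (c • a) b = c * dot a b := by
  simp only [dot, Prod.smul_fst, Prod.smul_snd, real_inner_smul_left]; ring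

theorem dot_add_left (a b w : Pt d d') : dot (a + b) w = dot a w + dot b w := by
  simp only [dot, Prod.fst_add, Prod.snd_add, inner_add_left]; ring

theorem prox_optimistic_step {Y : Set (Vec d')} (hc : IsClosed Y) (hconv : Convex ℝ Y)
    (b u u' w : Pt d d') (hw : w.2 ∈ Y) :
    dot u (prox Y b u' - w) ≤ sqNorm (w - b) / 2 - sqNorm (w - prox Y b u) / 2
      - sqNorm (prox Y b u - prox Y b u') / 4 - sqNorm (prox Y b u' - b) / 2
      + sqNorm (u - u') := by
  have hne : Y.Nonempty := ⟨_, hw⟩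
  have h1 := (isProj_univ (b.1 - u'.1)).optimistic_step (isProj_univ (b.1 - u.1))
    (Set.mem_univ w.1)
  have h2 := (isProj_proj hc hconv hne (b.2 - u'.2)).optimistic_step
    (isProj_proj hc hconv hne (b.2 - u.2)) hw
  simp only [prox_eq hc hconv hne, dot, sqNorm, Prod.fst_sub, Prod.snd_sub]
  linarith

section Ogda

variable {Y : Set (Vec d')} {G : Pt d d' → Ξ → Pt d d'} {η : ℝ} {s : ℕ → Ξ} {z₀ : Pt d d'}

theorem ogda_mem (hc : IsClosed Y) (hconv : Convex ℝ Y) (h0 : z₀.2 ∈ Y) (t : ℕ) :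
    (ogda Y G η s z₀ t).1.2 ∈ Y ∧ (ogda Y G η s z₀ t).2.2 ∈ Y := by
  cases t with
  | zero => exact ⟨h0, h0⟩
  | succ t =>
    simp only [ogda, prox_eq hc hconv ⟨_, h0⟩]
    exact ⟨(isProj_proj hc hconv ⟨_, h0⟩ _).1, (isProj_proj hc hconv ⟨_, h0⟩ _).1⟩

/-- Regret of OGDA for a field which is a Lipschitz field `F` up to the errors `ζ`. -/
theorem ogda_regret (hc : IsClosed Y) (hconv : Convex ℝ Y) (h0 : z₀.2 ∈ Y) {M : ℝ}
    (F : Pt d d' → Pt d d')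
    (hF : ∀ z w : Pt d d', z.2 ∈ Y → w.2 ∈ Y → sqNorm (F z - F w) ≤ M * sqNorm (z - w))
    (hM : 0 ≤ M) (hη : 24 * (η ^ 2 * M) ≤ 1) (ζ : ℕ → Pt d d')
    (hζ : ∀ t, G (ogda Y G η s z₀ t).1 (s t) = F (ogda Y G η s z₀ t).1 + ζ t)
    (w : Pt d d') (hw : w.2 ∈ Y) (T : ℕ) :
    η * ∑ t ∈ Finset.range T, dot (F (ogda Y G η s z₀ (t + 1)).1) ((ogda Y G η s z₀ (t + 1)).1 - w)
      ≤ sqNorm (w - z₀) / 2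
        + 3 * η ^ 2 * ∑ t ∈ Finset.range T, (sqNorm (ζ (t + 1)) + sqNorm (ζ t))
        - η * ∑ t ∈ Finset.range T, dot (ζ (t + 1)) ((ogda Y G η s z₀ (t + 1)).1 - w) := by
  set z : ℕ → Pt d d' := fun t => (ogda Y G η s z₀ t).1 with hz
  set zt : ℕ → Pt d d' := fun t => (ogda Y G η s z₀ t).2 with hzt
  have key : ∀ t, η * dot (F (z (t + 1))) (z (t + 1) - w) + η * dot (ζ (t + 1)) (z (t + 1) - w)
      ≤ sqNorm (w - zt t) / 2 - sqNorm (w - zt (t + 1)) / 2 - sqNorm (zt (t + 1) - z (t + 1)) / 4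
        + sqNorm (zt t - z t) / 4
        + 3 * η ^ 2 * (sqNorm (ζ (t + 1)) + sqNorm (ζ t)) := by
    intro t
    have h1 := prox_optimistic_step hc hconv (zt t) (η • G (z (t + 1)) (s (t + 1)))
      (η • G (z t) (s t)) w hw
    change dot (η • G (z (t + 1)) (s (t + 1))) (z (t + 1) - w) ≤ sqNorm (w - zt t) / 2
      - sqNorm (w - zt (t + 1)) / 2 - sqNorm (zt (t + 1) - z (t + 1)) / 4
      - sqNorm (z (t + 1) - zt t) / 2
      + sqNorm (η • G (z (t + 1)) (s (t + 1)) - η • G (z t) (s t)) at h1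
    rw [← smul_sub, sqNorm_smul, dot_smul_left, hζ, hζ, dot_add_left] at h1
    change η * (dot (F (z (t + 1))) _ + _) ≤ _ + η ^ 2 * sqNorm (F (z (t + 1)) + ζ (t + 1)
      - (F (z t) + ζ t)) at h1
    have h2 : sqNorm (F (z (t + 1)) + ζ (t + 1) - (F (z t) + ζ t))
        ≤ 3 * (sqNorm (F (z (t + 1)) - F (z t)) + sqNorm (ζ (t + 1)) + sqNorm (ζ t)) := by
      have := sqNorm_add_le_three (F (z (t + 1)) - F (z t)) (ζ (t + 1)) (-(ζ t))
      have e : sqNorm (-(ζ t)) = sqNorm (ζ t) := by simp [sqNorm]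
      rw [e] at this
      convert this using 2
      abel
    have h3 := hF (z (t + 1)) (z t) (ogda_mem hc hconv h0 _).1 (ogda_mem hc hconv h0 _).1
    have h4 : sqNorm (z (t + 1) - z t) ≤ 2 * (sqNorm (z (t + 1) - zt t) + sqNorm (zt t - z t)) := by
      simpa using sqNorm_add_le_two (z (t + 1) - zt t) (zt t - z t)
    have h5 : η ^ 2 * sqNorm (F (z (t + 1)) + ζ (t + 1) - (F (z t) + ζ t)) ≤ η ^ 2 *
        (3 * (M * (2 * (sqNorm (z (t + 1) - zt t) + sqNorm (zt t - z t)))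
          + sqNorm (ζ (t + 1)) + sqNorm (ζ t))) := by
      gcongr
      refine h2.trans ?_
      gcongr
      exact h3.trans (by gcongr)
    -- `z (t+1) - z t` is split at `zt t`. The first piece is absorbed by `-sqNorm (z (t+1) - zt t)
    -- / 2`, the second is the quarter left over from the previous step, so it telescopes.
    have h6 : 6 * (η ^ 2 * M) * (sqNorm (z (t + 1) - zt t) + sqNorm (zt t - z t))
        ≤ 1 / 4 * (sqNorm (z (t + 1) - zt t) + sqNorm (zt t - z t)) :=
      mul_le_mul_of_nonneg_right (by linarith) (add_nonneg (sqNorm_nonneg _) (sqNorm_nonneg _))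
    have h7 := sqNorm_nonneg (z (t + 1) - zt t)
    linarith
  have total : ∀ T, η * ∑ t ∈ Finset.range T, dot (F (z (t + 1))) (z (t + 1) - w)
      + η * ∑ t ∈ Finset.range T, dot (ζ (t + 1)) (z (t + 1) - w)
      ≤ sqNorm (w - zt 0) / 2 - sqNorm (w - zt T) / 2 - sqNorm (zt T - z T) / 4
        + sqNorm (zt 0 - z 0) / 4
        + 3 * η ^ 2 * ∑ t ∈ Finset.range T, (sqNorm (ζ (t + 1)) + sqNorm (ζ t)) := by
    intro T
    induction T with
    | zero => simp
    | succ T ih =>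
      simp only [Finset.sum_range_succ, mul_add] at ih ⊢
      have := key T
      linarith
  have h := total T
  have e0 : sqNorm (zt 0 - z 0) = 0 := by simp [hz, hzt, ogda, sqNorm]
  have e1 : zt 0 = z₀ := rfl
  rw [e0, e1] at h
  linarith [sqNorm_nonneg (w - zt T), sqNorm_nonneg (zt T - z T)]

end Ogda

end PES

namespace PES

/-! ### Minimization of regularized functions -/

section Minimization

open Filter Topology

/-- `u - v` has a minimum at `a`. Applied to `f(·, y) ≤ P` with equality at one point, this plays
the role of Danskin's theorem. -/
theorem hasGradientAt_eq_of_le {n : ℕ} {u v : Vec n → ℝ} {a g g' : Vec n}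
    (hu : HasGradientAt u g a) (hv : HasGradientAt v g' a) (hle : ∀ x, v x ≤ u x)
    (heq : v a = u a) : g = g' := by
  have hmin : IsLocalMin (u - v) a := Eventually.of_forall fun x => by
    simp only [Pi.sub_apply]; linarith [hle x]
  have h0 := hmin.hasFDerivAt_eq_zero (hu.hasFDerivAt.sub hv.hasFDerivAt)
  rw [← map_sub, map_eq_zero_iff _ (InnerProductSpace.toDual ℝ (Vec n)).injective] at h0
  exact sub_eq_zero.1 h0

theorem hasGradientAt_half_sq_dist {n : ℕ} (γ : ℝ) (b a : Vec n) :
    HasGradientAt (fun x : Vec n => γ / 2 * ‖x - b‖ ^ 2) (γ • (a - b)) a := by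
  rw [hasGradientAt_iff_hasFDerivAt]
  have h := (((hasFDerivAt_id a).sub_const b).norm_sq).const_mul (γ / 2)
  refine h.congr_fderiv ?_
  ext v
  change γ / 2 * (2 • inner ℝ (a - b) v) = inner ℝ (γ • (a - b)) v
  rw [real_inner_smul_left, nsmul_eq_mul]
  push_cast
  ring

/-- The proximal point of a differentiable function that is bounded below. -/
theorem exists_prox_point {n : ℕ} {u : Vec n → ℝ} {g : Vec n → Vec n}
    (hu : ∀ x, HasGradientAt u (g x) x) {m : ℝ} (hm : ∀ x, m ≤ u x) {γ : ℝ} (hγ : 0 < γ)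
    (b : Vec n) :
    ∃ a, (∀ x, u a + γ / 2 * ‖a - b‖ ^ 2 ≤ u x + γ / 2 * ‖x - b‖ ^ 2) ∧
      g a = -(γ • (a - b)) := by
  have hcont : Continuous u := continuous_iff_continuousAt.2 fun x => (hu x).continuousAt
  have hlim : Tendsto (fun x => u x + γ / 2 * ‖x - b‖ ^ 2) (cocompact (Vec n)) atTop := by
    have h1 : Tendsto (fun x : Vec n => ‖x - b‖) (cocompact (Vec n)) atTop :=
      tendsto_norm_cocompact_atTop.comp
        (Homeomorph.subRight b).isClosedEmbedding.tendsto_cocompact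
    have h2 := ((tendsto_pow_atTop two_ne_zero).comp h1).const_mul_atTop (half_pos hγ)
    exact tendsto_atTop_mono (fun x => by simp only [Function.comp]; linarith [hm x])
      (tendsto_atTop_add_const_left _ m h2)
  obtain ⟨a, ha⟩ := Continuous.exists_forall_le (by fun_prop) hlim
  refine ⟨a, ha, ?_⟩
  -- Minimality of `a` says that a concave parabola touches `u` from below at `a`.
  have h := hasGradientAt_eq_of_le
    (v := fun x => u a + γ / 2 * ‖a - b‖ ^ 2 - γ / 2 * ‖x - b‖ ^ 2) (g' := -(γ • (a - b)))
    (hu a) ?_ (fun x => by linarith [ha x]) (by ring)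
  · exact h
  · have h1 := (hasGradientAt_half_sq_dist γ b a).hasFDerivAt.const_sub
      (u a + γ / 2 * ‖a - b‖ ^ 2)
    rw [hasGradientAt_iff_hasFDerivAt, map_neg]
    exact h1

theorem sq_dist_expand {n : ℕ} (x a b : Vec n) :
    ‖x - b‖ ^ 2 = ‖x - a‖ ^ 2 + 2 * inner ℝ (a - b) (x - a) + ‖a - b‖ ^ 2 := by
  rw [real_inner_comm, ← norm_add_sq_real]; congr 2; abel

theorem IsWeaklyConvex.regularized {n : ℕ} {u : Vec n → ℝ} {g : Vec n → Vec n} {ρ : ℝ}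
    (h : IsWeaklyConvex ρ u g) (γ : ℝ) (b x a : Vec n) :
    u a + γ / 2 * ‖a - b‖ ^ 2 + inner ℝ (g a + γ • (a - b)) (x - a) + (γ - ρ) / 2 * ‖x - a‖ ^ 2
      ≤ u x + γ / 2 * ‖x - b‖ ^ 2 := by
  have h1 := h x a
  rw [sq_dist_expand x a b, inner_add_left, real_inner_smul_left]
  linarith

theorem IsWeaklyConvex.prox_growth {n : ℕ} {u : Vec n → ℝ} {g : Vec n → Vec n} {ρ γ : ℝ}
    (h : IsWeaklyConvex ρ u g) {a b : Vec n} (ha : g a = -(γ • (a - b))) (x : Vec n) :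
    u a + γ / 2 * ‖a - b‖ ^ 2 + (γ - ρ) / 2 * ‖x - a‖ ^ 2 ≤ u x + γ / 2 * ‖x - b‖ ^ 2 := by
  have h1 := h.regularized γ b x a
  rw [ha, neg_add_cancel, inner_zero_left] at h1
  linarith

/-- First-order upper bound for a strongly concave function differentiable along its domain. -/
theorem _root_.StrongConcaveOn.le_gradient {E : Type*} [NormedAddCommGroup E] [InnerProductSpace ℝ E]
    [CompleteSpace E] {Y : Set E} {m : ℝ} {h : E → ℝ} {g y y' : E}
    (hh : StrongConcaveOn Y m h) (hy : y ∈ Y) (hy' : y' ∈ Y) (hg : HasGradientWithinAt h g Y y) :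
    h y' ≤ h y + inner ℝ g (y' - y) - m / 2 * ‖y' - y‖ ^ 2 := by
  -- The derivative exists only along `Y`, so strong concavity is divided by `t` and passed to the
  -- limit on the segment from `y` to `y'`, over `t ∈ (0, 1)`.
  have hl : HasDerivWithinAt (fun t : ℝ => y + t • (y' - y)) (y' - y) (Set.Ioo 0 1) 0 := by
    have := (((hasDerivAt_id (0 : ℝ)).smul_const (y' - y)).const_add y).hasDerivWithinAt
      (s := Set.Ioo 0 1)
    simpa using this
  have hmaps : Set.MapsTo (fun t : ℝ => y + t • (y' - y)) (Set.Ioo 0 1) Y := fun t ht =>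
    hh.1.add_smul_sub_mem hy hy' ⟨ht.1.le, ht.2.le⟩
  have hd := (hg.hasFDerivWithinAt).comp_hasDerivWithinAt_of_eq 0 hl hmaps (by simp)
  rw [hasDerivWithinAt_iff_tendsto_slope' (by simp)] at hd
  have hcomb := hh.2 hy hy'
  have hlow : Tendsto (fun t : ℝ => h y' - h y + (1 - t) * (m / 2 * ‖y' - y‖ ^ 2))
      (𝓝[Set.Ioo 0 1] 0) (𝓝 (h y' - h y + (1 - 0) * (m / 2 * ‖y' - y‖ ^ 2))) :=
    (Continuous.tendsto (by fun_prop) 0).mono_left nhdsWithin_le_nhds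
  have hne : (𝓝[Set.Ioo (0 : ℝ) 1] 0).NeBot := left_nhdsWithin_Ioo_neBot one_pos
  have hle := le_of_tendsto_of_tendsto hlow hd (eventually_mem_nhdsWithin.mono fun t ht => by
    have h1 := hcomb (a := 1 - t) (b := t) (by linarith [ht.2]) ht.1.le (by ring)
    have e : (1 - t) • y + t • y' = y + t • (y' - y) := by
      rw [smul_sub, sub_smul, one_smul]; abel
    rw [e, norm_sub_rev] at h1
    simp only [smul_eq_mul] at h1
    simp only [slope_def_field, Function.comp, zero_smul, add_zero, sub_zero]
    rw [le_div_iff₀ ht.1]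
    linarith)
  rw [InnerProductSpace.toDual_apply_apply] at hle
  linarith

/-- The same limit along a segment, with `h ≤ h y` on the segment in place of a derivative. -/
theorem _root_.StrongConcaveOn.le_max {E : Type*} [NormedAddCommGroup E] [NormedSpace ℝ E]
    {Y : Set E} {m : ℝ} {h : E → ℝ} {y y' : E}
    (hh : StrongConcaveOn Y m h) (hy : y ∈ Y) (hy' : y' ∈ Y) (hmax : ∀ w ∈ Y, h w ≤ h y) :
    h y' ≤ h y - m / 2 * ‖y' - y‖ ^ 2 := by
  have hcomb := hh.2 hy hy'
  have hconv : Convex ℝ Y := hh.1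
  have hlow : Tendsto (fun t : ℝ => h y' - h y + (1 - t) * (m / 2 * ‖y' - y‖ ^ 2))
      (𝓝[Set.Ioo 0 1] 0) (𝓝 (h y' - h y + (1 - 0) * (m / 2 * ‖y' - y‖ ^ 2))) :=
    (Continuous.tendsto (by fun_prop) 0).mono_left nhdsWithin_le_nhds
  have hne : (𝓝[Set.Ioo (0 : ℝ) 1] 0).NeBot := left_nhdsWithin_Ioo_neBot one_pos
  have hle := le_of_tendsto hlow (b := 0) (eventually_mem_nhdsWithin.mono fun t ht => by
    have h1 := hcomb (a := 1 - t) (b := t) (by linarith [ht.2]) ht.1.le (by ring)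
    have h2 := hmax _ (hconv hy hy' (show 0 ≤ 1 - t by linarith [ht.2]) ht.1.le (by ring))
    rw [norm_sub_rev] at h1
    simp only [smul_eq_mul] at h1
    have h3 : t * (h y' - h y + (1 - t) * (m / 2 * ‖y' - y‖ ^ 2)) ≤ t * 0 := by linarith
    exact le_of_mul_le_mul_left h3 ht.1)
  linarith

theorem _root_.StrongConcaveOn.exists_max {n : ℕ} {Y : Set (Vec n)} {m : ℝ} {h : Vec n → ℝ}
    {g : Vec n → Vec n} (hh : StrongConcaveOn Y m h) (hm : 0 < m) (hc : IsClosed Y)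
    (hne : Y.Nonempty) (hg : ∀ y ∈ Y, HasGradientWithinAt h (g y) Y y) :
    ∃ y ∈ Y, ∀ w ∈ Y, h w ≤ h y := by
  obtain ⟨y, hy⟩ := hne
  have hcont : ContinuousOn h Y := fun w hw => (hg w hw).continuousWithinAt
  obtain ⟨a, ha, hmax⟩ := hcont.exists_isMaxOn' hc hy (by
    rw [eventually_inf_principal]
    have h1 : Tendsto (fun x : Vec n => ‖x - y‖) (cocompact (Vec n)) atTop :=
      tendsto_norm_cocompact_atTop.comp
        (Homeomorph.subRight y).isClosedEmbedding.tendsto_cocompact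
    -- Beyond radius `2‖g y‖/m` the quadratic upper bound at `y` lies below `h y`, so a maximum over
    -- the closed set exists.
    filter_upwards [h1.eventually_ge_atTop (2 * ‖g y‖ / m)] with w hw hwY
    have h2 := hh.le_gradient hy hwY (hg y hy)
    have h3 := real_inner_le_norm (g y) (w - y)
    rw [div_le_iff₀ hm] at hw
    nlinarith [norm_nonneg (w - y)])
  exact ⟨a, ha, fun w hw => hmax hw⟩

end Minimization

/-! ### The regularized game -/

/-- The dual function of `f(x, y) + (γ/2) ‖x - b‖²`. -/
noncomputable def proxDual {d d' : ℕ} (f : Vec d → Vec d' → ℝ) (γ : ℝ) (b : Vec d) (y : Vec d') :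
    ℝ :=
  sInf (Set.range fun x => f x y + γ / 2 * ‖x - b‖ ^ 2)

/-- The duality gap of `f(x, y) + (γ/2) ‖x - b‖²`. -/
noncomputable def proxGap {d d' : ℕ} (Y : Set (Vec d')) (f : Vec d → Vec d' → ℝ) (γ : ℝ)
    (b : Vec d) (z : Pt d d') : ℝ :=
  primal Y f z.1 + γ / 2 * ‖z.1 - b‖ ^ 2 - proxDual f γ b z.2

/-- The minimal value of the primal function. -/
noncomputable def primalMin {d d' : ℕ} (Y : Set (Vec d')) (f : Vec d → Vec d' → ℝ) : ℝ :=
  sInf (Set.range (primal Y f))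

/-- The standing assumptions on the objective and the regularization parameter `γ`. -/
structure RegularGame {d d' : ℕ} (ℓ μ μx μy L ρ γ : ℝ) (Y : Set (Vec d'))
    (f : Vec d → Vec d' → ℝ) (gx : Vec d → Vec d' → Vec d) (gy : Vec d → Vec d' → Vec d') :
    Prop where
  closed : IsClosed Y
  convex : Convex ℝ Y
  nonempty : Y.Nonempty
  grad : IsPartialGradients Y f gx gy
  lip : IsLipschitzField ℓ Y gx gy
  conc : ∀ x, StrongConcaveOn Y μy (fun y => f x y)
  smooth : IsSmooth L (primal Y f)
  pl : IsPL μ (primal Y f) (gradient (primal Y f))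
  plx : ∀ y ∈ Y, IsPL μx (fun x => f x y) (fun x => gx x y)
  wc : ∀ y ∈ Y, IsWeaklyConvex ρ (fun x => f x y) (fun x => gx x y)
  ℓ_pos : 0 < ℓ
  μ_pos : 0 < μ
  μx_pos : 0 < μx
  μy_pos : 0 < μy
  ρ_pos : 0 < ρ
  γ_pos : 0 < γ
  ρ_le : 2 * ρ ≤ γ
  γ_le_μ : 4 * γ ≤ μ
  γ_le_ℓ : γ ≤ 2 * ℓ

theorem sInf_range_eq {α : Type*} {u : α → ℝ} {a : α} (h : ∀ x, u a ≤ u x) :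
    sInf (Set.range u) = u a :=
  IsLeast.csInf_eq ⟨⟨a, rfl⟩, by rintro _ ⟨x, rfl⟩; exact h x⟩

namespace RegularGame

variable {d d' : ℕ} {ℓ μ μx μy L ρ γ : ℝ} {Y : Set (Vec d')} {f : Vec d → Vec d' → ℝ}
  {gx : Vec d → Vec d' → Vec d} {gy : Vec d → Vec d' → Vec d'}

theorem exists_primal_eq (H : RegularGame ℓ μ μx μy L ρ γ Y f gx gy) (x : Vec d) :
    ∃ y ∈ Y, primal Y f x = f x y ∧ ∀ w ∈ Y, f x w ≤ f x y - μy / 2 * ‖w - y‖ ^ 2 := by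
  obtain ⟨y, hy, hmax⟩ := (H.conc x).exists_max H.μy_pos H.closed H.nonempty
    (fun y hy => (H.grad x y hy).2)
  refine ⟨y, hy, ?_, fun w hw => (H.conc x).le_max hy hw hmax⟩
  exact IsGreatest.csSup_eq ⟨⟨y, hy, rfl⟩, by rintro _ ⟨w, hw, rfl⟩; exact hmax w hw⟩

theorem le_primal (H : RegularGame ℓ μ μx μy L ρ γ Y f gx gy) (x : Vec d) {y : Vec d'}
    (hy : y ∈ Y) : f x y ≤ primal Y f x := by
  obtain ⟨w, -, h1, h2⟩ := H.exists_primal_eq x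
  have := h2 y hy
  have := mul_nonneg (half_pos H.μy_pos).le (sq_nonneg ‖y - w‖)
  linarith

theorem exists_dual_eq (H : RegularGame ℓ μ μx μy L ρ γ Y f gx gy) {y : Vec d'} (hy : y ∈ Y) :
    ∃ x, dual f y = f x y ∧ (∀ x', f x y ≤ f x' y) ∧
      ∀ x', 2 * μx * (f x' y - f x y) ≤ ‖gx x' y‖ ^ 2 := by
  obtain ⟨x, h1, h2⟩ := H.plx y hy
  exact ⟨x, sInf_range_eq h1, h1, h2⟩

theorem exists_primalMin_eq (H : RegularGame ℓ μ μx μy L ρ γ Y f gx gy) :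
    ∃ x, primalMin Y f = primal Y f x ∧ (∀ x', primal Y f x ≤ primal Y f x') ∧
      ∀ x', 2 * μ * (primal Y f x' - primal Y f x) ≤ ‖gradient (primal Y f) x'‖ ^ 2 := by
  obtain ⟨x, h1, h2⟩ := H.pl
  exact ⟨x, sInf_range_eq h1, h1, h2⟩

theorem primalMin_le (H : RegularGame ℓ μ μx μy L ρ γ Y f gx gy) (x : Vec d) :
    primalMin Y f ≤ primal Y f x := by
  obtain ⟨xs, h1, h2, -⟩ := H.exists_primalMin_eq
  rw [h1]; exact h2 x

theorem primal_sub_primalMin_le (H : RegularGame ℓ μ μx μy L ρ γ Y f gx gy) (x : Vec d) :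
    2 * μ * (primal Y f x - primalMin Y f) ≤ ‖gradient (primal Y f) x‖ ^ 2 := by
  obtain ⟨xs, h1, -, h2⟩ := H.exists_primalMin_eq
  rw [h1]; exact h2 x

theorem dual_le (H : RegularGame ℓ μ μx μy L ρ γ Y f gx gy) (x : Vec d) {y : Vec d'}
    (hy : y ∈ Y) : dual f y ≤ f x y := by
  obtain ⟨xs, h1, h2, -⟩ := H.exists_dual_eq hy
  rw [h1]; exact h2 x

theorem exists_proxDual_eq (H : RegularGame ℓ μ μx μy L ρ γ Y f gx gy) (b : Vec d) {y : Vec d'}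
    (hy : y ∈ Y) :
    ∃ a, proxDual f γ b y = f a y + γ / 2 * ‖a - b‖ ^ 2 ∧ gx a y = -(γ • (a - b)) ∧
      ∀ x, f a y + γ / 2 * ‖a - b‖ ^ 2 + γ / 4 * ‖x - a‖ ^ 2 ≤ f x y + γ / 2 * ‖x - b‖ ^ 2 := by
  obtain ⟨a, h1, h2⟩ := exists_prox_point (fun x => (H.grad x y hy).1) (fun x => H.dual_le x hy)
    H.γ_pos b
  refine ⟨a, sInf_range_eq h1, h2, fun x => ?_⟩
  have h3 := (H.wc y hy).prox_growth h2 x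
  have h4 := mul_le_mul_of_nonneg_right (show γ / 4 ≤ (γ - ρ) / 2 by linarith [H.ρ_le])
    (sq_nonneg ‖x - a‖)
  linarith

theorem proxDual_le (H : RegularGame ℓ μ μx μy L ρ γ Y f gx gy) (b x : Vec d) {y : Vec d'}
    (hy : y ∈ Y) : proxDual f γ b y ≤ f x y + γ / 2 * ‖x - b‖ ^ 2 := by
  obtain ⟨a, h1, -, h2⟩ := H.exists_proxDual_eq b hy
  rw [h1]
  linarith [h2 x, mul_nonneg H.γ_pos.le (sq_nonneg ‖x - a‖)]

theorem dual_le_proxDual (H : RegularGame ℓ μ μx μy L ρ γ Y f gx gy) (b : Vec d) {y : Vec d'}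
    (hy : y ∈ Y) : dual f y ≤ proxDual f γ b y := by
  obtain ⟨a, h1, -, -⟩ := H.exists_proxDual_eq b hy
  rw [h1]
  linarith [H.dual_le a hy, mul_nonneg H.γ_pos.le (sq_nonneg ‖a - b‖)]

/-- A saddle point of the regularized game. -/
theorem exists_saddle (H : RegularGame ℓ μ μx μy L ρ γ Y f gx gy) (b : Vec d) :
    ∃ xs, ∃ ys ∈ Y, primal Y f xs = f xs ys ∧ gradient (primal Y f) xs = -(γ • (xs - b)) ∧
      (∀ w ∈ Y, f xs w ≤ f xs ys - μy / 2 * ‖w - ys‖ ^ 2) ∧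
      ∀ x, f xs ys + γ / 2 * ‖xs - b‖ ^ 2 + γ / 4 * ‖x - xs‖ ^ 2
        ≤ f x ys + γ / 2 * ‖x - b‖ ^ 2 := by
  have hP : ∀ x, HasGradientAt (primal Y f) (gradient (primal Y f) x) x := fun x =>
    (H.smooth.1 x).hasGradientAt
  obtain ⟨xs, -, h2⟩ := exists_prox_point hP H.primalMin_le H.γ_pos b
  obtain ⟨ys, hys, h3, h4⟩ := H.exists_primal_eq xs
  refine ⟨xs, ys, hys, h3, h2, h4, fun x => ?_⟩
  -- `P` and `f(·, ys)` touch at `xs`, so `xs` is also critical for the regularized `f(·, ys)`,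
  -- which is strongly convex. This yields the saddle point without a minimax theorem.
  have h5 := hasGradientAt_eq_of_le (hP xs) (H.grad xs ys hys).1 (fun x => H.le_primal x hys)
    h3.symm
  have h6 := (H.wc ys hys).prox_growth (h5.symm.trans h2) x
  have h7 := mul_le_mul_of_nonneg_right (show γ / 4 ≤ (γ - ρ) / 2 by linarith [H.ρ_le])
    (sq_nonneg ‖x - xs‖)
  linarith

theorem primal_sub_primalMin_le_gap (H : RegularGame ℓ μ μx μy L ρ γ Y f gx gy) (x : Vec d)
    {y : Vec d'} (hy : y ∈ Y) : primal Y f x - primalMin Y f ≤ gap Y f (x, y) := by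
  obtain ⟨xs, h1, -, -⟩ := H.exists_primalMin_eq
  have := H.dual_le xs hy
  have := H.le_primal xs hy
  simp only [gap]
  linarith

theorem gap_nonneg (H : RegularGame ℓ μ μx μy L ρ γ Y f gx gy) {z : Pt d d'} (hz : z.2 ∈ Y) :
    0 ≤ gap Y f z := by
  have := H.primalMin_le z.1
  have := H.primal_sub_primalMin_le_gap z.1 hz
  linarith

theorem proxGap_nonneg (H : RegularGame ℓ μ μx μy L ρ γ Y f gx gy) (b : Vec d) {z : Pt d d'}
    (hz : z.2 ∈ Y) : 0 ≤ proxGap Y f γ b z := by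
  have := H.le_primal z.1 hz
  have := H.proxDual_le b z.1 hz
  simp only [proxGap]
  linarith

theorem proxGap_le_gap (H : RegularGame ℓ μ μx μy L ρ γ Y f gx gy) (b : Vec d) {z : Pt d d'}
    (hz : z.2 ∈ Y) : proxGap Y f γ b z ≤ gap Y f z + γ / 2 * ‖z.1 - b‖ ^ 2 := by
  have := H.dual_le_proxDual b hz
  simp only [proxGap, gap]
  linarith

theorem proxGap_self_le_gap (H : RegularGame ℓ μ μx μy L ρ γ Y f gx gy) {z : Pt d d'}
    (hz : z.2 ∈ Y) : proxGap Y f γ z.1 z ≤ gap Y f z := by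
  simpa using H.proxGap_le_gap z.1 hz

/-- The `μx`-PL condition turns the regularized gap at its own center into the gap. -/
theorem gap_le_proxGap (H : RegularGame ℓ μ μx μy L ρ γ Y f gx gy) {z : Pt d d'}
    (hz : z.2 ∈ Y) : gap Y f z ≤ (3 + 2 * (γ / μx)) * proxGap Y f γ z.1 z := by
  obtain ⟨a, h1, h2, h3⟩ := H.exists_proxDual_eq z.1 hz
  obtain ⟨xs, h4, -, h5⟩ := H.exists_dual_eq hz
  have h6 := h5 a
  rw [h2, norm_neg, norm_smul, mul_pow, Real.norm_eq_abs, sq_abs] at h6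
  have h7 := h3 z.1
  rw [norm_sub_rev z.1 a] at h7
  simp only [sub_self, norm_zero] at h7
  have h8 := H.le_primal z.1 hz
  have hμ := H.μx_pos
  have hγ := H.γ_pos
  set q := ‖a - z.1‖ ^ 2 with hq
  -- At the proximal point `a` the gradient is `-γ(a - z.1)`, so PL bounds the suboptimality of `a`
  -- by the squared proximal displacement; `h10` bounds that by the gap.
  have h9 : f a z.2 - f xs z.2 ≤ γ / μx * (γ / 2 * q) := by
    rw [div_mul_eq_mul_div, le_div_iff₀ hμ]; linarith
  simp only [gap, proxGap, sub_self, norm_zero]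
  rw [h1, h4]
  have h10 : γ / 2 * q ≤ 2 * (primal Y f z.1 - (f a z.2 + γ / 2 * q)) := by linarith
  have h11 := mul_le_mul_of_nonneg_left h10 (div_pos hγ hμ).le
  linarith

/-- Best responses to `z₁` in the regularized game, and their distance to `z₀`. -/
theorem exists_best_response (H : RegularGame ℓ μ μx μy L ρ γ Y f gx gy) {lam : ℝ} (hlam : 0 < lam)
    (hγ : lam ≤ γ / 2) (hμy : lam ≤ μy) {z₀ z₁ : Pt d d'} (h0 : z₀.2 ∈ Y) (h1 : z₁.2 ∈ Y) :
    ∃ w : Pt d d', w.2 ∈ Y ∧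
      proxGap Y f γ z₀.1 z₁ = (f z₁.1 w.2 + γ / 2 * ‖z₁.1 - z₀.1‖ ^ 2)
        - (f w.1 z₁.2 + γ / 2 * ‖w.1 - z₀.1‖ ^ 2) ∧
      lam * sqNorm (w - z₀) ≤ 4 * (proxGap Y f γ z₀.1 z₁ + proxGap Y f γ z₀.1 z₀) := by
  obtain ⟨a, a1, -, a2⟩ := H.exists_proxDual_eq z₀.1 h1
  obtain ⟨v, hv, v1, v2⟩ := H.exists_primal_eq z₁.1
  -- Triangle inequality through the saddle point: its distance to the best responses is paid by the
  -- gap at `z₁`, its distance to `z₀` by the gap at `z₀`.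
  obtain ⟨xs, ys, hys, s1, -, s2, s3⟩ := H.exists_saddle z₀.1
  refine ⟨(a, v), hv, by simp only [proxGap, a1, v1], ?_⟩
  have e1 := s3 z₀.1
  have e2 := s2 z₀.2 h0
  have e3 := H.proxDual_le z₀.1 xs h0
  have e4 := H.le_primal z₀.1 hys
  have e5 := a2 xs
  have e6 := s2 z₁.2 h1
  have e7 := v2 ys hys
  have e8 := s3 z₁.1
  have n1 := norm_add_sq_le_two (a - xs) (xs - z₀.1)
  have n2 := norm_add_sq_le_two (v - ys) (ys - z₀.2)
  rw [sub_add_sub_cancel, norm_sub_rev a xs, norm_sub_rev xs z₀.1] at n1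
  rw [sub_add_sub_cancel, norm_sub_rev v ys, norm_sub_rev ys z₀.2] at n2
  simp only [sqNorm, Prod.fst_sub, Prod.snd_sub, proxGap, sub_self, norm_zero] at e1 ⊢
  have m1 := mul_le_mul_of_nonneg_right hγ (sq_nonneg ‖z₀.1 - xs‖)
  have m2 := mul_le_mul_of_nonneg_right hγ (sq_nonneg ‖xs - a‖)
  have m3 := mul_le_mul_of_nonneg_right hμy (sq_nonneg ‖ys - v‖)
  have m4 := mul_le_mul_of_nonneg_right hμy (sq_nonneg ‖z₀.2 - ys‖)
  have m5 := mul_le_mul_of_nonneg_left n1 hlam.le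
  have m6 := mul_le_mul_of_nonneg_left n2 hlam.le
  have p1 := mul_nonneg H.γ_pos.le (sq_nonneg ‖z₁.1 - xs‖)
  have p2 := mul_nonneg H.μy_pos.le (sq_nonneg ‖z₁.2 - ys‖)
  rw [a1]
  linarith

theorem prox_step_sq_le (H : RegularGame ℓ μ μx μy L ρ γ Y f gx gy) (b : Vec d) {z : Pt d d'}
    (hz : z.2 ∈ Y) :
    primal Y f z.1 + γ / 2 * ‖z.1 - b‖ ^ 2 ≤ primal Y f b + proxGap Y f γ b z := by
  have h1 := H.proxDual_le b b hz
  have h2 := H.le_primal b hz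
  simp only [sub_self, norm_zero] at h1
  simp only [proxGap]
  linarith

theorem sq_dist_le_weighted {n : ℕ} (a b c : Vec n) {q : ℝ} (hq : 0 < q) :
    ‖a - c‖ ^ 2 ≤ (1 + q) * ‖a - b‖ ^ 2 + (1 + q⁻¹) * ‖b - c‖ ^ 2 := by
  have h1 : ‖a - c‖ ≤ ‖a - b‖ + ‖b - c‖ := norm_sub_le_norm_sub_add_norm_sub a b c
  have h2 : ‖a - c‖ ^ 2 ≤ (‖a - b‖ + ‖b - c‖) ^ 2 := by gcongr
  have h3 : 0 ≤ q⁻¹ * (q * ‖a - b‖ - ‖b - c‖) ^ 2 := by positivity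
  have h4 : q⁻¹ * (q * ‖a - b‖ - ‖b - c‖) ^ 2
      = q * ‖a - b‖ ^ 2 - 2 * (‖a - b‖ * ‖b - c‖) + q⁻¹ * ‖b - c‖ ^ 2 := by
    field_simp; ring
  linarith

/-- An inexact proximal point step contracts the primal suboptimality. -/
theorem primal_contraction (H : RegularGame ℓ μ μx μy L ρ γ Y f gx gy) (b : Vec d) {z : Pt d d'}
    (hz : z.2 ∈ Y) :
    primal Y f z.1 - primalMin Y f
      ≤ 2 / 5 * (primal Y f b - primalMin Y f) + 7 * proxGap Y f γ b z := by
  obtain ⟨xs, ys, hys, s1, s2, s3, s4⟩ := H.exists_saddle b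
  have h1 := H.primal_sub_primalMin_le xs
  rw [s2, norm_neg, norm_smul, mul_pow, Real.norm_eq_abs, sq_abs] at h1
  have h2 := s4 b
  have h3 := H.le_primal b hys
  have h4 := H.proxDual_le b xs hz
  have h5 := H.le_primal xs hz
  have h6 := s4 z.1
  have h7 := H.le_primal z.1 hys
  -- With weight 3, `γ/2 (‖xs - b‖² - ‖z.1 - b‖²)` is at most `γ/8 ‖xs - b‖² + 3γ/2 ‖z.1 - xs‖²`,
  -- and the last term is at most 6 gaps: together with the gap itself, 7.
  have h8 := sq_dist_le_weighted xs z.1 b (q := 3) (by norm_num)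
  rw [norm_sub_rev xs z.1] at h8
  have h9 := mul_nonneg H.γ_pos.le (sq_nonneg ‖b - xs‖)
  have h10 : primal Y f xs - primalMin Y f ≤ γ / 8 * ‖xs - b‖ ^ 2 := by
    have h11 : μ * (primal Y f xs - primalMin Y f) ≤ μ * (γ / 8 * ‖xs - b‖ ^ 2) := by
      have := mul_le_mul_of_nonneg_right H.γ_le_μ
        (mul_nonneg H.γ_pos.le (sq_nonneg ‖xs - b‖))
      linarith
    exact le_of_mul_le_mul_left h11 H.μ_pos
  have h11 := mul_le_mul_of_nonneg_left h8 H.γ_pos.le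
  simp only [sub_self, norm_zero] at h2
  simp only [proxGap]
  linarith

/-- Moving the center of the regularization to the current point. -/
theorem proxGap_recenter (H : RegularGame ℓ μ μx μy L ρ γ Y f gx gy) (b : Vec d) {z : Pt d d'}
    (hz : z.2 ∈ Y) :
    proxGap Y f γ z.1 z
      ≤ 10 * proxGap Y f γ b z + 8 * (primal Y f b - primalMin Y f) := by
  obtain ⟨a, a1, -, a2⟩ := H.exists_proxDual_eq z.1 hz
  have h1 := H.proxDual_le b a hz
  have h2 := a2 z.1
  have h3 := H.le_primal z.1 hz
  have h4 := H.prox_step_sq_le b hz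
  have h5 := H.primalMin_le z.1
  -- With weight `1/4`, the term in `‖a - z.1‖²` is at most half of the recentered gap and moves to
  -- the left-hand side. The rest, a multiple of `γ‖z.1 - b‖²`, is bounded by `h4`.
  have h6 := mul_le_mul_of_nonneg_left (sq_dist_le_weighted a z.1 b (q := 1 / 4) (by norm_num))
    H.γ_pos.le
  rw [norm_sub_rev z.1 a] at h2
  simp only [proxGap, sub_self, norm_zero] at h2 h4 ⊢
  rw [a1]
  norm_num at h6 ⊢
  linarith

/-- Used only for integrability, hence the crude constant depending on `L` and `y₀`. The gap is cut
at `min P`, `f 0 y₀` and `f 0 z.2`: the outer pieces are bounded by PL with Lipschitz gradients, `f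
0 y₀ - f 0 z.2` by concavity, and the remaining one is constant. -/
theorem gap_le_sq (H : RegularGame ℓ μ μx μy L ρ γ Y f gx gy) :
    ∃ C, 0 ≤ C ∧ ∀ z : Pt d d', z.2 ∈ Y → gap Y f z ≤ C * (1 + ‖z.1‖ ^ 2 + ‖z.2‖ ^ 2) := by
  obtain ⟨y₀, hy₀⟩ := H.nonempty
  set A := 2 * (‖gradient (primal Y f) 0‖ ^ 2 + L ^ 2) / (2 * μ) with hA
  set B := 2 * (‖gx 0 y₀‖ ^ 2 + 2 * ℓ ^ 2 * (1 + ‖y₀‖ ^ 2)) / (2 * μx) with hB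
  set D := (2 * (‖gy 0 y₀‖ ^ 2 + 2 * ℓ ^ 2 * (1 + ‖y₀‖ ^ 2)) + 2 * (1 + ‖y₀‖ ^ 2)) / 2 with hD
  set Q := |primalMin Y f - f 0 y₀| with hQ
  have hA0 : 0 ≤ A := by have := H.μ_pos; positivity
  have hB0 : 0 ≤ B := by have := H.μx_pos; positivity
  have hD0 : 0 ≤ D := by positivity
  have hQ0 : 0 ≤ Q := abs_nonneg _
  refine ⟨A + B + D + Q, by positivity, fun z hz => ?_⟩
  set N := 1 + ‖z.1‖ ^ 2 + ‖z.2‖ ^ 2 with hN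
  have hN1 : 1 ≤ N := by rw [hN]; linarith [sq_nonneg ‖z.1‖, sq_nonneg ‖z.2‖]
  have hNx : ‖z.1‖ ^ 2 ≤ N := by rw [hN]; linarith [sq_nonneg ‖z.1‖, sq_nonneg ‖z.2‖]
  have hNy : ‖z.2‖ ^ 2 + 1 ≤ N := by rw [hN]; linarith [sq_nonneg ‖z.1‖, sq_nonneg ‖z.2‖]
  have hdist : ‖z.2 - y₀‖ ^ 2 ≤ 2 * (1 + ‖y₀‖ ^ 2) * N := by
    have := norm_add_sq_le_two z.2 (-y₀)
    rw [← sub_eq_add_neg, norm_neg] at this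
    have h' := mul_le_mul_of_nonneg_left hN1 (sq_nonneg ‖y₀‖)
    linarith
  have b1 : primal Y f z.1 - primalMin Y f ≤ A * N := by
    have h1 := H.primal_sub_primalMin_le z.1
    have h2 := H.smooth.2 z.1 0
    have h3 := norm_add_sq_le_two (gradient (primal Y f) 0)
      (gradient (primal Y f) z.1 - gradient (primal Y f) 0)
    rw [add_sub_cancel] at h3
    have h4 : ‖gradient (primal Y f) z.1 - gradient (primal Y f) 0‖ ^ 2 ≤ (L * ‖z.1 - 0‖) ^ 2 := by
      gcongr
    rw [mul_pow, sub_zero] at h4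
    have h5 := mul_le_mul_of_nonneg_left hNx (sq_nonneg L)
    have h6 := mul_le_mul_of_nonneg_left hN1 (sq_nonneg ‖gradient (primal Y f) 0‖)
    rw [hA, div_mul_eq_mul_div, le_div_iff₀ (by linarith [H.μ_pos])]
    linarith
  have hgrad := H.lip 0 0 z.2 hz y₀ hy₀
  simp only [sub_self, norm_zero] at hgrad
  have hl := mul_le_mul_of_nonneg_left hdist (sq_nonneg ℓ)
  have b2 : f 0 z.2 - dual f z.2 ≤ B * N := by
    obtain ⟨xs, h1, -, h2⟩ := H.exists_dual_eq hz
    have h3 := norm_add_sq_le_two (gx 0 y₀) (gx 0 z.2 - gx 0 y₀)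
    rw [add_sub_cancel] at h3
    have h4 := h2 0
    have h6 := mul_le_mul_of_nonneg_left hN1 (sq_nonneg ‖gx 0 y₀‖)
    rw [h1, hB, div_mul_eq_mul_div, le_div_iff₀ (by linarith [H.μx_pos])]
    linarith [sq_nonneg ‖gy 0 z.2 - gy 0 y₀‖]
  have b3 : f 0 y₀ - f 0 z.2 ≤ D * N := by
    have h1 := (H.conc 0).le_gradient hz hy₀ (H.grad 0 z.2 hz).2
    have h2 := real_inner_le_norm (gy 0 z.2) (y₀ - z.2)
    rw [norm_sub_rev] at h1 h2
    have h3 := norm_add_sq_le_two (gy 0 y₀) (gy 0 z.2 - gy 0 y₀)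
    rw [add_sub_cancel] at h3
    have h6 := mul_le_mul_of_nonneg_left hN1 (sq_nonneg ‖gy 0 y₀‖)
    have h7 := mul_nonneg H.μy_pos.le (sq_nonneg ‖z.2 - y₀‖)
    have h8 := sq_nonneg (‖gy 0 z.2‖ - ‖z.2 - y₀‖)
    rw [hD]
    linarith [sq_nonneg ‖gx 0 z.2 - gx 0 y₀‖]
  have b4 : primalMin Y f - f 0 y₀ ≤ Q * N :=
    (le_abs_self _).trans (le_mul_of_one_le_right hQ0 hN1)
  simp only [gap]
  linarith

end RegularGame

/-- If `ℓ` is below both `μ/8` and `μy`, the objective is constant. -/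
theorem gap_nonpos_of_small_lipschitz {d d' : ℕ} {ℓ μ μx μy L ρ γ : ℝ} {Y : Set (Vec d')}
    {f : Vec d → Vec d' → ℝ} {gx : Vec d → Vec d' → Vec d} {gy : Vec d → Vec d' → Vec d'}
    (H : RegularGame ℓ μ μx μy L ρ γ Y f gx gy) (hρ : ρ ≤ ℓ) (hμ : ℓ < μ / 8) (hμy : ℓ < μy)
    {z : Pt d d'} (hz : z.2 ∈ Y) : gap Y f z ≤ 0 := by
  have hℓ := H.ℓ_pos
  -- `-gy` is `μy`-strongly monotone yet `ℓ`-Lipschitz with `ℓ < μy`, so `Y` is a single point.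
  have hsub : ∀ y ∈ Y, y = z.2 := by
    intro y hy
    have h1 := (H.conc 0).le_gradient hz hy (H.grad 0 z.2 hz).2
    have h2 := (H.conc 0).le_gradient hy hz (H.grad 0 y hy).2
    have h3 : ‖gy 0 y - gy 0 z.2‖ ≤ ℓ * ‖y - z.2‖ := by
      have := H.lip 0 0 y hy z.2 hz
      simp only [sub_self, norm_zero] at this
      refine abs_le_of_sq_le_sq' ?_ (by positivity) |>.2
      rw [mul_pow]
      linarith [sq_nonneg ‖gx 0 y - gx 0 z.2‖]
    have h4 := real_inner_le_norm (gy 0 y - gy 0 z.2) (z.2 - y)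
    rw [norm_sub_rev z.2 y] at h2 h4
    have h5 : inner ℝ (gy 0 y - gy 0 z.2) (z.2 - y)
        = inner ℝ (gy 0 y) (z.2 - y) + inner ℝ (gy 0 z.2) (y - z.2) := by
      rw [inner_sub_left, ← neg_sub y z.2, inner_neg_right, inner_neg_right]; ring
    have h6 := mul_le_mul_of_nonneg_right h3 (norm_nonneg (y - z.2))
    have h7 : (μy - ℓ) * ‖y - z.2‖ ^ 2 ≤ 0 := by linarith
    have h8 : ‖y - z.2‖ ^ 2 ≤ 0 := nonpos_of_mul_nonpos_right h7 (by linarith)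
    simpa [sub_eq_zero] using le_antisymm h8 (sq_nonneg _)
  have hP : ∀ x, primal Y f x = f x z.2 := by
    intro x
    obtain ⟨y, hy, h1, -⟩ := H.exists_primal_eq x
    rw [h1, hsub y hy]
  have hmin : ∀ x, dual f z.2 ≤ f x z.2 := fun x => H.dual_le x hz
  have hDP : primalMin Y f ≤ dual f z.2 := by
    obtain ⟨xs, h1, -, -⟩ := H.exists_dual_eq hz
    rw [h1, ← hP]
    exact H.primalMin_le xs
  have hg : gradient (primal Y f) z.1 = gx z.1 z.2 :=
    hasGradientAt_eq_of_le (H.smooth.1 z.1).hasGradientAt (H.grad z.1 z.2 hz).1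
      (fun x => H.le_primal x hz) (hP z.1).symm
  have hpl := H.primal_sub_primalMin_le z.1
  rw [hg] at hpl
  set g := gx z.1 z.2 with hgdef
  -- A gradient step of length `1/(3ℓ)` decreases `P` by at least `t‖g‖²/2`, so `‖g‖² ≤ 6ℓ(P - min
  -- P)`. Against PL with `2μ > 6ℓ`, this forces `P = min P`.
  set t : ℝ := 1 / (3 * ℓ) with ht
  have htℓ : ℓ * t = 1 / 3 := by rw [ht]; field_simp
  have ht0 : 0 < t := by positivity
  have h1 := H.wc z.2 hz z.1 (z.1 - t • g)
  have h2 : ‖gx (z.1 - t • g) z.2 - g‖ ≤ ℓ * (t * ‖g‖) := by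
    have := H.lip (z.1 - t • g) z.1 z.2 hz z.2 hz
    have e : ‖z.1 - t • g - z.1‖ = t * ‖g‖ := by
      rw [sub_sub_cancel_left, norm_neg, norm_smul, Real.norm_of_nonneg ht0.le]
    rw [e] at this
    simp only [sub_self, norm_zero] at this
    refine abs_le_of_sq_le_sq' ?_ (by positivity) |>.2
    rw [mul_pow]
    linarith [sq_nonneg ‖gy (z.1 - t • g) z.2 - gy z.1 z.2‖]
  rw [← mul_assoc, htℓ] at h2
  rw [sub_sub_cancel] at h1
  have h3 := neg_le_of_abs_le (abs_real_inner_le_norm (gx (z.1 - t • g) z.2 - g) g)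
  have h4 := mul_le_mul_of_nonneg_right h2 (norm_nonneg g)
  rw [inner_sub_left, real_inner_self_eq_norm_sq] at h3
  rw [real_inner_smul_right, norm_smul, Real.norm_of_nonneg ht0.le] at h1
  have h5 : t * (2 / 3 * ‖g‖ ^ 2) ≤ t * inner ℝ (gx (z.1 - t • g) z.2) g :=
    mul_le_mul_of_nonneg_left (by linarith) ht0.le
  have h6 : ρ / 2 * (t * ‖g‖) ^ 2 ≤ t * (1 / 6 * ‖g‖ ^ 2) := by
    have : ρ * (t * (t * ‖g‖ ^ 2)) ≤ ℓ * (t * (t * ‖g‖ ^ 2)) := by gcongr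
    have e : ℓ * (t * (t * ‖g‖ ^ 2)) = 1 / 3 * (t * ‖g‖ ^ 2) := by rw [← htℓ]; ring
    linarith
  have h7 := hmin (z.1 - t • g)
  have h8 : t * (1 / 2 * ‖g‖ ^ 2) ≤ primal Y f z.1 - primalMin Y f := by
    rw [hP]; linarith
  have h9 : ‖g‖ ^ 2 ≤ 6 * ℓ * (primal Y f z.1 - primalMin Y f) := by
    have := mul_le_mul_of_nonneg_left h8 (show 0 ≤ 6 * ℓ by positivity)
    have e : 6 * ℓ * (t * (1 / 2 * ‖g‖ ^ 2)) = 3 * (ℓ * t) * ‖g‖ ^ 2 := by ring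
    rw [e, htℓ] at this
    linarith
  have h10 : (2 * μ - 6 * ℓ) * (primal Y f z.1 - primalMin Y f) ≤ 0 := by linarith
  have h11 := nonpos_of_mul_nonpos_right h10 (by linarith)
  simp only [gap]
  linarith

end PES

/-! ### Pathwise analysis of one epoch -/

namespace PES

variable {d d' : ℕ} {Ξ : Type*}

/-- The field `(∇ₓ f_k(z), -∇_y f_k(z))` of `f_k(x, y) = f(x, y) + (γ/2) ‖x - b‖²`. -/
noncomputable def meanField (gx : Vec d → Vec d' → Vec d) (gy : Vec d → Vec d' → Vec d') (γ : ℝ)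
    (b : Vec d) (z : Pt d d') : Pt d d' :=
  (gx z.1 z.2 + γ • (z.1 - b), -gy z.1 z.2)

theorem dot_le_young (a v : Pt d d') (η : ℝ) :
    η * dot a v ≤ 2 * η ^ 2 * sqNorm a + sqNorm v / 8 := by
  have h : ∀ {n : ℕ} (p q : Vec n), η * inner ℝ p q ≤ 2 * η ^ 2 * ‖p‖ ^ 2 + ‖q‖ ^ 2 / 8 := by
    intro n p q
    have h1 := sq_nonneg ‖(4 * η) • p - q‖
    rw [norm_sub_sq_real, real_inner_smul_left, norm_smul, mul_pow, Real.norm_eq_abs, sq_abs] at h1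
    linarith
  have h1 := h a.1 v.1
  have h2 := h a.2 v.2
  simp only [dot, sqNorm]
  linarith

theorem dot_sub_right (a v w : Pt d d') : dot a (v - w) = dot a v - dot a w := by
  simp only [dot, Prod.fst_sub, Prod.snd_sub, inner_sub_right]; ring

theorem dot_sum_left {ι : Type*} (s : Finset ι) (a : ι → Pt d d') (v : Pt d d') :
    dot (∑ i ∈ s, a i) v = ∑ i ∈ s, dot (a i) v := by
  simp only [dot, Prod.fst_sum, Prod.snd_sum, sum_inner, Finset.sum_add_distrib]

theorem sum_Icc_one_eq {M : Type*} [AddCommMonoid M] (u : ℕ → M) (T : ℕ) :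
    ∑ t ∈ Finset.Icc 1 T, u t = ∑ t ∈ Finset.range T, u (t + 1) := by
  rw [Finset.range_eq_Ico, Finset.sum_Ico_add' u 0 T 1]; rfl

namespace RegularGame

variable {ℓ μ μx μy L ρ γ : ℝ} {Y : Set (Vec d')} {f : Vec d → Vec d' → ℝ}
  {gx : Vec d → Vec d' → Vec d} {gy : Vec d → Vec d' → Vec d'}

/-- `10 = 2(1 + 2²)`: the regularization adds a `γ`-Lipschitz term with `γ ≤ 2ℓ`. -/
theorem meanField_lipschitz (H : RegularGame ℓ μ μx μy L ρ γ Y f gx gy) (b : Vec d)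
    (z w : Pt d d') (hz : z.2 ∈ Y) (hw : w.2 ∈ Y) :
    sqNorm (meanField gx gy γ b z - meanField gx gy γ b w) ≤ 10 * ℓ ^ 2 * sqNorm (z - w) := by
  have h1 := H.lip z.1 w.1 z.2 hz w.2 hw
  have h2 := norm_add_sq_le_two (gx z.1 z.2 - gx w.1 w.2) (γ • (z.1 - w.1))
  rw [norm_smul, mul_pow, Real.norm_eq_abs, sq_abs] at h2
  have h3 : γ ^ 2 ≤ (2 * ℓ) ^ 2 := pow_le_pow_left₀ H.γ_pos.le H.γ_le_ℓ 2
  have h4 := mul_le_mul_of_nonneg_right h3 (sq_nonneg ‖z.1 - w.1‖)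
  have e1 : gx z.1 z.2 + γ • (z.1 - b) - (gx w.1 w.2 + γ • (w.1 - b))
      = gx z.1 z.2 - gx w.1 w.2 + γ • (z.1 - w.1) := by module
  simp only [sqNorm, meanField, Prod.fst_sub, Prod.snd_sub, neg_sub_neg, e1]
  rw [norm_sub_rev (gy w.1 w.2)]
  have h5 := mul_nonneg (sq_nonneg ℓ) (sq_nonneg ‖z.2 - w.2‖)
  linarith [sq_nonneg ‖gy z.1 z.2 - gy w.1 w.2‖]

theorem le_dot_meanField (H : RegularGame ℓ μ μx μy L ρ γ Y f gx gy) (b : Vec d)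
    (z w : Pt d d') (hz : z.2 ∈ Y) (hw : w.2 ∈ Y) :
    (f z.1 w.2 + γ / 2 * ‖z.1 - b‖ ^ 2) - (f w.1 z.2 + γ / 2 * ‖w.1 - b‖ ^ 2)
      ≤ dot (meanField gx gy γ b z) (z - w) := by
  have h1 := (H.wc z.2 hz).regularized γ b w.1 z.1
  have h2 := (H.conc z.1).le_gradient hz hw (H.grad z.1 z.2 hz).2
  have h3 := mul_nonneg (show 0 ≤ γ - ρ by linarith [H.ρ_le, H.ρ_pos]) (sq_nonneg ‖w.1 - z.1‖)
  have h4 := mul_nonneg H.μy_pos.le (sq_nonneg ‖w.2 - z.2‖)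
  simp only [dot, meanField, Prod.fst_sub, Prod.snd_sub]
  rw [← neg_sub w.1 z.1, ← neg_sub w.2 z.2, inner_neg_right, inner_neg_neg]
  linarith

theorem average_mem (H : RegularGame ℓ μ μx μy L ρ γ Y f gx gy) {T : ℕ} (hT : 0 < T)
    (y : ℕ → Vec d') (hy : ∀ t, y t ∈ Y) : (1 / (T : ℝ)) • ∑ t ∈ Finset.range T, y t ∈ Y := by
  have hT' : (T : ℝ) ≠ 0 := by positivity
  rw [Finset.smul_sum]
  refine H.convex.sum_mem (fun _ _ => by positivity) ?_ fun t _ => hy t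
  simp [hT']

/-- Jensen's inequality for the regularized game. -/
theorem jensen_average (H : RegularGame ℓ μ μx μy L ρ γ Y f gx gy) (b : Vec d) {T : ℕ}
    (hT : 0 < T) (z : ℕ → Pt d d') (hz : ∀ t, (z t).2 ∈ Y) (w : Pt d d') (hw : w.2 ∈ Y)
    (a : Pt d d') (ha : a = (1 / (T : ℝ)) • ∑ t ∈ Finset.range T, z t) :
    T * ((f a.1 w.2 + γ / 2 * ‖a.1 - b‖ ^ 2) - (f w.1 a.2 + γ / 2 * ‖w.1 - b‖ ^ 2))
      ≤ ∑ t ∈ Finset.range T, ((f (z t).1 w.2 + γ / 2 * ‖(z t).1 - b‖ ^ 2)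
        - (f w.1 (z t).2 + γ / 2 * ‖w.1 - b‖ ^ 2)) := by
  have hT' : (T : ℝ) ≠ 0 := by positivity
  have ha1 : a.1 = (1 / (T : ℝ)) • ∑ t ∈ Finset.range T, (z t).1 := by
    rw [ha, Prod.smul_fst, Prod.fst_sum]
  have ha2 : a.2 = (1 / (T : ℝ)) • ∑ t ∈ Finset.range T, (z t).2 := by
    rw [ha, Prod.smul_snd, Prod.snd_sum]
  have hmem : a.2 ∈ Y := ha2 ▸ H.average_mem hT _ hz
  have s1 : ∑ t ∈ Finset.range T, ((z t).1 - a.1) = 0 := by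
    rw [Finset.sum_sub_distrib, Finset.sum_const, Finset.card_range, ← Nat.cast_smul_eq_nsmul ℝ,
      ha1, smul_smul, mul_one_div_cancel hT', one_smul, sub_self]
  have s2 : ∑ t ∈ Finset.range T, ((z t).2 - a.2) = 0 := by
    rw [Finset.sum_sub_distrib, Finset.sum_const, Finset.card_range, ← Nat.cast_smul_eq_nsmul ℝ,
      ha2, smul_smul, mul_one_div_cancel hT', one_smul, sub_self]
  -- All first-order bounds are taken at the average `a`, so their linear terms sum to zero.
  have key : ∀ t ∈ Finset.range T,
      ((f a.1 w.2 + γ / 2 * ‖a.1 - b‖ ^ 2) - (f w.1 a.2 + γ / 2 * ‖w.1 - b‖ ^ 2))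
        + (inner ℝ (gx a.1 w.2 + γ • (a.1 - b)) ((z t).1 - a.1)
          - inner ℝ (gy w.1 a.2) ((z t).2 - a.2))
      ≤ (f (z t).1 w.2 + γ / 2 * ‖(z t).1 - b‖ ^ 2)
        - (f w.1 (z t).2 + γ / 2 * ‖w.1 - b‖ ^ 2) := by
    intro t _
    have h1 := (H.wc w.2 hw).regularized γ b (z t).1 a.1
    have h2 := (H.conc w.1).le_gradient hmem (hz t) (H.grad w.1 a.2 hmem).2
    have h3 := mul_nonneg (show 0 ≤ γ - ρ by linarith [H.ρ_le, H.ρ_pos])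
      (sq_nonneg ‖(z t).1 - a.1‖)
    have h4 := mul_nonneg H.μy_pos.le (sq_nonneg ‖(z t).2 - a.2‖)
    linarith
  have h := Finset.sum_le_sum key
  rw [Finset.sum_add_distrib, Finset.sum_sub_distrib (fun t => inner ℝ _ ((z t).1 - a.1)),
    ← inner_sum, ← inner_sum, s1, s2, inner_zero_right, inner_zero_right, Finset.sum_const,
    Finset.card_range, nsmul_eq_mul] at h
  linarith

/-- The stochastic error of one epoch of `T` steps with gradient errors `ζ` along the iterates
`z`. -/
noncomputable def _root_.PES.epochError (η : ℝ) (T : ℕ) (z ζ : ℕ → Pt d d') : ℝ :=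
  3 * η ^ 2 * ∑ t ∈ Finset.range T, (sqNorm (ζ (t + 1)) + sqNorm (ζ t))
    - η * ∑ t ∈ Finset.range T, dot (ζ (t + 1)) (z (t + 1) - z 0)
    + 2 * η ^ 2 * sqNorm (∑ t ∈ Finset.range T, ζ (t + 1))

/-- One epoch decreases the regularized duality gap, up to the stochastic error. -/
theorem epoch_pathwise (H : RegularGame ℓ μ μx μy L ρ γ Y f gx gy) {lam : ℝ} (hlam : 0 < lam)
    (hγ : lam ≤ γ / 2) (hμy : lam ≤ μy) {η : ℝ} (hη : 0 < η) (hηℓ : 240 * (η ^ 2 * ℓ ^ 2) ≤ 1)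
    {T : ℕ} (hT : 0 < T) {Gx : Vec d → Vec d' → Ξ → Vec d} {Gy : Vec d → Vec d' → Ξ → Vec d'}
    {s : ℕ → Ξ} {z₀ : Pt d d'} (h0 : z₀.2 ∈ Y) (z ζ : ℕ → Pt d d')
    (hz : ∀ t, z t = (ogda Y (regField Gx Gy γ z₀.1) η s z₀ t).1)
    (hζ : ∀ t, regField Gx Gy γ z₀.1 (z t) (s t) = meanField gx gy γ z₀.1 (z t) + ζ t) :
    (ogdaAverage Y (regField Gx Gy γ z₀.1) η T s z₀).2 ∈ Y ∧
    lam * (η * T) * proxGap Y f γ z₀.1 (ogdaAverage Y (regField Gx Gy γ z₀.1) η T s z₀)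
      ≤ 5 / 2 * (proxGap Y f γ z₀.1 (ogdaAverage Y (regField Gx Gy γ z₀.1) η T s z₀)
          + proxGap Y f γ z₀.1 z₀) + lam * epochError η T z ζ := by
  set a := ogdaAverage Y (regField Gx Gy γ z₀.1) η T s z₀ with ha
  have hzY : ∀ t, (z t).2 ∈ Y := fun t => by
    rw [hz]; exact (ogda_mem H.closed H.convex h0 t).1
  have ha' : a = (1 / (T : ℝ)) • ∑ t ∈ Finset.range T, z (t + 1) := by
    rw [ha, ogdaAverage, sum_Icc_one_eq]
    simp only [hz]
  have haY : a.2 ∈ Y := by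
    rw [ha', Prod.smul_snd, Prod.snd_sum]
    exact H.average_mem hT _ fun t => hzY (t + 1)
  refine ⟨haY, ?_⟩
  obtain ⟨w, hw, hw1, hw2⟩ := H.exists_best_response hlam hγ hμy h0 haY
  have h1 := ogda_regret (G := regField Gx Gy γ z₀.1) (η := η) (s := s) (M := 10 * ℓ ^ 2)
    H.closed H.convex h0 (meanField gx gy γ z₀.1)
    (fun z w hz hw => H.meanField_lipschitz z₀.1 z w hz hw) (by positivity) (by linarith) ζ
    (fun t => by rw [← hz]; exact hζ t) w hw T
  simp only [← hz] at h1
  have h2 := H.jensen_average z₀.1 hT (fun t => z (t + 1)) (fun t => hzY (t + 1)) w hw a ha'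
  rw [← hw1] at h2
  have h3 := h2.trans (Finset.sum_le_sum fun t _ =>
    H.le_dot_meanField z₀.1 (z (t + 1)) w (hzY (t + 1)) hw)
  have h4 := mul_le_mul_of_nonneg_left h3 hη.le
  -- `w` depends on the whole noise, so `z - w` is split at `z 0 = z₀`: the first sum has adapted
  -- coefficients, and the second is treated by Young's inequality.
  have h5 : ∑ t ∈ Finset.range T, dot (ζ (t + 1)) (z (t + 1) - w)
      = ∑ t ∈ Finset.range T, dot (ζ (t + 1)) (z (t + 1) - z 0)
        - dot (∑ t ∈ Finset.range T, ζ (t + 1)) (w - z₀) := by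
    rw [dot_sum_left, ← Finset.sum_sub_distrib]
    refine Finset.sum_congr rfl fun t _ => ?_
    rw [hz 0]
    simp only [dot_sub_right, ogda]
    ring
  have h6 := dot_le_young (∑ t ∈ Finset.range T, ζ (t + 1)) (w - z₀) η
  -- `5/8 = 1/2 + 1/8`, from the regret and from Young; the factor 4 of `hw2` turns it into `5/2`.
  have h7 : η * (T * proxGap Y f γ z₀.1 a) ≤ 5 / 8 * sqNorm (w - z₀) + epochError η T z ζ := by
    rw [h5] at h1
    simp only [epochError]
    linarith
  have h8 := mul_le_mul_of_nonneg_left h7 hlam.le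
  linarith

end RegularGame

end PES

namespace PES

/-! ### Noise of an oracle queried at points independent of the sample -/

section Noise

variable {d d' n : ℕ} {Ξ Ω : Type*} [MeasurableSpace Ξ] {mΩ : MeasurableSpace Ω} {Pr : Measure Ω}

/-- When the sample is drawn as `ξ`, the noise `N z` is centered with variance at most `σ²` at
every query point `z`. -/
structure IsCenteredNoise (Pr : Measure Ω) (ξ : Ω → Ξ) (N : Pt d d' × Ξ → Vec n) (σ : ℝ) :
    Prop where
  integrable : ∀ z, Integrable (fun ω => N (z, ξ ω)) Pr
  mean : ∀ z, ∫ ω, N (z, ξ ω) ∂Pr = 0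
  sq_integrable : ∀ z, Integrable (fun ω => ‖N (z, ξ ω)‖ ^ 2) Pr
  variance : ∀ z, ∫ ω, ‖N (z, ξ ω)‖ ^ 2 ∂Pr ≤ σ ^ 2

theorem MemLp.integrable_norm_sq' {X : Ω → Vec n} (hX : MemLp X 2 Pr) :
    Integrable (fun ω => ‖X ω‖ ^ 2) Pr :=
  (memLp_two_iff_integrable_sq_norm hX.1).1 hX

theorem MemLp.integrable_inner_vec {X X' : Ω → Vec n} (hX : MemLp X 2 Pr) (hX' : MemLp X' 2 Pr) :
    Integrable (fun ω => inner ℝ (X ω) (X' ω)) Pr := by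
  refine (((integrable_norm_sq' hX).add (integrable_norm_sq' hX'))).mono'
    (hX.1.inner hX'.1) (Filter.Eventually.of_forall fun ω => ?_)
  have h := abs_real_inner_le_norm (X ω) (X' ω)
  simp only [Real.norm_eq_abs, Pi.add_apply]
  nlinarith [sq_nonneg (‖X ω‖ - ‖X' ω‖), sq_nonneg ‖X ω‖, sq_nonneg ‖X' ω‖]

theorem indepFun_of_measurable {m : MeasurableSpace Ω} {β : Type*} [MeasurableSpace β]
    {ξ : Ω → Ξ} (hind : Indep m (MeasurableSpace.comap ξ inferInstance) Pr) {Z : Ω → β}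
    (hZ : Measurable[m] Z) : IndepFun Z ξ Pr :=
  indep_of_indep_of_le_left hind hZ.comap_le

variable [IsProbabilityMeasure Pr] {ξ : Ω → Ξ} {N : Pt d d' × Ξ → Vec n} {σ : ℝ}

/-- Independence makes the joint law a product, so Tonelli allows the query point to be frozen.
Working with `lintegral` first gives integrability as a by-product. -/
theorem IsCenteredNoise.memLp (hN : IsCenteredNoise Pr ξ N σ) (hNm : Measurable N)
    (hξ : Measurable ξ) {Z : Ω → Pt d d'} (hZ : Measurable Z) (hind : IndepFun Z ξ Pr) :
    MemLp (fun ω => N (Z ω, ξ ω)) 2 Pr ∧ ∫ ω, ‖N (Z ω, ξ ω)‖ ^ 2 ∂Pr ≤ σ ^ 2 := by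
  have hm : Measurable fun ω => N (Z ω, ξ ω) := hNm.comp (hZ.prodMk hξ)
  have hNq : Measurable fun q => ENNReal.ofReal (‖N q‖ ^ 2) := by fun_prop
  have hbound : ∫⁻ ω, ENNReal.ofReal (‖N (Z ω, ξ ω)‖ ^ 2) ∂Pr ≤ ENNReal.ofReal (σ ^ 2) := by
    calc ∫⁻ ω, ENNReal.ofReal (‖N (Z ω, ξ ω)‖ ^ 2) ∂Pr
        = ∫⁻ q, ENNReal.ofReal (‖N q‖ ^ 2) ∂((Pr.map Z).prod (Pr.map ξ)) := by
          rw [← (indepFun_iff_map_prod_eq_prod_map_map hZ.aemeasurable hξ.aemeasurable).1 hind,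
            lintegral_map hNq (hZ.prodMk hξ)]
      _ = ∫⁻ z, ∫⁻ x, ENNReal.ofReal (‖N (z, x)‖ ^ 2) ∂(Pr.map ξ) ∂(Pr.map Z) :=
          lintegral_prod _ hNq.aemeasurable
      _ ≤ ∫⁻ _, ENNReal.ofReal (σ ^ 2) ∂(Pr.map Z) := by
          refine lintegral_mono fun z => ?_
          rw [lintegral_map (by fun_prop) hξ,
            ← ofReal_integral_eq_lintegral_ofReal (hN.sq_integrable z)
              (Filter.Eventually.of_forall fun ω => sq_nonneg _)]
          exact ENNReal.ofReal_le_ofReal (hN.variance z)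
      _ = ENNReal.ofReal (σ ^ 2) := by
          have := Measure.isProbabilityMeasure_map (μ := Pr) hZ.aemeasurable
          simp
  have hint : Integrable (fun ω => ‖N (Z ω, ξ ω)‖ ^ 2) Pr := by
    refine ⟨(hm.norm.pow_const 2).aestronglyMeasurable, ?_⟩
    rw [hasFiniteIntegral_iff_ofReal (Filter.Eventually.of_forall fun ω => sq_nonneg _)]
    exact hbound.trans_lt ENNReal.ofReal_lt_top
  refine ⟨(memLp_two_iff_integrable_sq_norm hm.aestronglyMeasurable).2 hint, ?_⟩
  rw [← ofReal_integral_eq_lintegral_ofReal hint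
    (Filter.Eventually.of_forall fun ω => sq_nonneg _)] at hbound
  exact (ENNReal.ofReal_le_ofReal_iff (sq_nonneg σ)).1 hbound

/-- Fubini with both the query point and the vector `B` frozen leaves the mean of the noise, which
is zero. Joint independence of `(Z, B)` from the sample is what is needed. -/
theorem IsCenteredNoise.integral_inner_eq_zero (hN : IsCenteredNoise Pr ξ N σ)
    (hNm : Measurable N) (hξ : Measurable ξ) {Z : Ω → Pt d d'} (hZ : Measurable Z)
    {B : Ω → Vec n} (hB : Measurable B) (hB2 : MemLp B 2 Pr)
    (hind : IndepFun (fun ω => (Z ω, B ω)) ξ Pr) :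
    ∫ ω, inner ℝ (N (Z ω, ξ ω)) (B ω) ∂Pr = 0 := by
  have hindZ : IndepFun Z ξ Pr := hind.comp measurable_fst measurable_id
  have hint := MemLp.integrable_inner_vec (hN.memLp hNm hξ hZ hindZ).1 hB2
  have hZB : Measurable fun ω => (Z ω, B ω) := hZ.prodMk hB
  set φ : (Pt d d' × Vec n) × Ξ → ℝ := fun q => inner ℝ (N (q.1.1, q.2)) q.1.2 with hφ
  have hφm : Measurable φ :=
    (hNm.comp (by fun_prop : Measurable fun q : (Pt d d' × Vec n) × Ξ => (q.1.1, q.2))).inner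
      (by fun_prop)
  have hmap := (indepFun_iff_map_prod_eq_prod_map_map hZB.aemeasurable hξ.aemeasurable).1 hind
  have hφint : Integrable φ ((Pr.map fun ω => (Z ω, B ω)).prod (Pr.map ξ)) := by
    rw [← hmap, integrable_map_measure hφm.aestronglyMeasurable (hZB.prodMk hξ).aemeasurable]
    exact hint
  have e : ∫ ω, inner ℝ (N (Z ω, ξ ω)) (B ω) ∂Pr
      = ∫ q, φ q ∂((Pr.map fun ω => (Z ω, B ω)).prod (Pr.map ξ)) := by
    rw [← hmap, integral_map (hZB.prodMk hξ).aemeasurable hφm.aestronglyMeasurable]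
  rw [e, integral_prod _ hφint]
  refine integral_eq_zero_of_ae (Filter.Eventually.of_forall fun q => ?_)
  simp only [Pi.zero_apply]
  rw [integral_map (f := fun x => φ (q, x)) hξ.aemeasurable
    (hφm.comp measurable_prodMk_left).aestronglyMeasurable]
  simp only [hφ]
  simp_rw [real_inner_comm q.2]
  rw [integral_inner (hN.integrable q.1), hN.mean, inner_zero_right]

end Noise

section NoiseSequence

variable {d d' n : ℕ} {Ξ Ω : Type*} [MeasurableSpace Ξ] {mΩ : MeasurableSpace Ω} {Pr : Measure Ω}

/-- Samples `s t` that are revealed at time `t + 1` of the filtration `ℱ` and are independent of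
the past. -/
structure IsSampleStream (Pr : Measure Ω) (ℱ : ℕ → MeasurableSpace Ω) (s : ℕ → Ω → Ξ) :
    Prop where
  mono : Monotone ℱ
  le : ∀ t, ℱ t ≤ mΩ
  measurable : ∀ t, Measurable[ℱ (t + 1)] (s t)
  indep : ∀ t, Indep (ℱ t) (MeasurableSpace.comap (s t) inferInstance) Pr

variable {ℱ : ℕ → MeasurableSpace Ω} {s : ℕ → Ω → Ξ} {N : Pt d d' × Ξ → Vec n} {σ : ℝ}
  {Z : ℕ → Ω → Pt d d'}

theorem IsSampleStream.measurable_noise (hs : IsSampleStream Pr ℱ s) (hNm : Measurable N)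
    (hZ : ∀ t, Measurable[ℱ t] (Z t)) (t : ℕ) :
    Measurable[ℱ (t + 1)] fun ω => N (Z t ω, s t ω) :=
  hNm.comp (Measurable.prodMk ((hZ t).mono (hs.mono t.le_succ) le_rfl) (hs.measurable t))

variable [IsProbabilityMeasure Pr]

theorem IsSampleStream.noise_memLp (hs : IsSampleStream Pr ℱ s) (hNm : Measurable N)
    (hN : ∀ t, IsCenteredNoise Pr (s t) N σ) (hZ : ∀ t, Measurable[ℱ t] (Z t)) (t : ℕ) :
    MemLp (fun ω => N (Z t ω, s t ω)) 2 Pr ∧ ∫ ω, ‖N (Z t ω, s t ω)‖ ^ 2 ∂Pr ≤ σ ^ 2 :=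
  (hN t).memLp hNm ((hs.measurable t).mono (hs.le _) le_rfl) ((hZ t).mono (hs.le _) le_rfl)
    (indepFun_of_measurable (hs.indep t) (hZ t))

theorem IsSampleStream.integral_noise_inner (hs : IsSampleStream Pr ℱ s) (hNm : Measurable N)
    (hN : ∀ t, IsCenteredNoise Pr (s t) N σ) (hZ : ∀ t, Measurable[ℱ t] (Z t)) (t : ℕ)
    {B : Ω → Vec n} (hB : Measurable[ℱ t] B) (hB2 : MemLp B 2 Pr) :
    ∫ ω, inner ℝ (N (Z t ω, s t ω)) (B ω) ∂Pr = 0 :=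
  (hN t).integral_inner_eq_zero hNm ((hs.measurable t).mono (hs.le _) le_rfl)
    ((hZ t).mono (hs.le _) le_rfl) (hB.mono (hs.le _) le_rfl) hB2
    (indepFun_of_measurable (hs.indep t) (Measurable.prodMk (hZ t) hB))

/-- Martingale increments are orthogonal. Measurability of the partial sum is carried through the
induction because the cross term needs it. -/
theorem IsSampleStream.noise_sum (hs : IsSampleStream Pr ℱ s) (hNm : Measurable N)
    (hN : ∀ t, IsCenteredNoise Pr (s t) N σ) (hZ : ∀ t, Measurable[ℱ t] (Z t)) (T : ℕ) :
    (Measurable[ℱ (T + 1)] fun ω => ∑ t ∈ Finset.range T, N (Z (t + 1) ω, s (t + 1) ω)) ∧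
    MemLp (fun ω => ∑ t ∈ Finset.range T, N (Z (t + 1) ω, s (t + 1) ω)) 2 Pr ∧
    ∫ ω, ‖∑ t ∈ Finset.range T, N (Z (t + 1) ω, s (t + 1) ω)‖ ^ 2 ∂Pr ≤ T * σ ^ 2 := by
  induction T with
  | zero => simp
  | succ T ih =>
    obtain ⟨ih1, ih2, ih3⟩ := ih
    have h1 := hs.measurable_noise hNm hZ (T + 1)
    have h2 := hs.noise_memLp hNm hN hZ (T + 1)
    have h3 := hs.integral_noise_inner hNm hN hZ (T + 1) ih1 ih2
    simp only [Finset.sum_range_succ]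
    refine ⟨(ih1.mono (hs.mono (Nat.le_succ _)) le_rfl).add h1, ih2.add h2.1, ?_⟩
    simp_rw [norm_add_sq_real]
    have i1 := MemLp.integrable_norm_sq' ih2
    have i2 := (MemLp.integrable_inner_vec ih2 h2.1).const_mul 2
    have i3 := MemLp.integrable_norm_sq' h2.1
    rw [integral_add (by exact i1.add i2) i3, integral_add i1 i2, integral_const_mul]
    simp_rw [real_inner_comm (∑ t ∈ Finset.range T, N (Z (t + 1) _, s (t + 1) _))] at h3
    rw [h3]
    push_cast
    linarith [h2.2]

end NoiseSequence

end PES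

/-! ### Expected stochastic error, and measurability of the oracle -/

namespace PES

section Epoch

variable {d d' : ℕ} {Ξ Ω : Type*} [MeasurableSpace Ξ] {mΩ : MeasurableSpace Ω} {Pr : Measure Ω}

/-- A square-integrable random point. -/
def IsL2 (Pr : Measure Ω) (Z : Ω → Pt d d') : Prop :=
  MemLp (fun ω => (Z ω).1) 2 Pr ∧ MemLp (fun ω => (Z ω).2) 2 Pr

theorem IsL2.sub {Z W : Ω → Pt d d'} (h : IsL2 Pr Z) (h' : IsL2 Pr W) :
    IsL2 Pr fun ω => Z ω - W ω :=
  ⟨h.1.sub h'.1, h.2.sub h'.2⟩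

theorem IsL2.memLp_of_growth [IsFiniteMeasure Pr] {n : ℕ} {Z : Ω → Pt d d'} (hZ : IsL2 Pr Z)
    {h : Ω → Vec n} (hm : AEStronglyMeasurable h Pr) {a b : ℝ}
    (hb : ∀ ω, ‖h ω‖ ≤ a + b * (‖(Z ω).1‖ + ‖(Z ω).2‖)) : MemLp h 2 Pr :=
  MemLp.mono' (g := fun ω => a + b * (‖(Z ω).1‖ + ‖(Z ω).2‖))
    ((memLp_const a).add ((hZ.1.norm.add hZ.2.norm).const_mul b)) hm
    (Filter.Eventually.of_forall hb)

/-- The noise of a stochastic oracle, extended to all query points by projection. -/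
noncomputable def oracleNoise {n : ℕ} (Y : Set (Vec d')) (G : Vec d → Vec d' → Ξ → Vec n)
    (g : Vec d → Vec d' → Vec n) (q : Pt d d' × Ξ) : Vec n :=
  G q.1.1 (proj Y q.1.2) q.2 - g q.1.1 (proj Y q.1.2)

/-- Measurable unbiased gradient estimators with variance at most `σ²` for the samples `s t`. -/
structure IsOracle (Pr : Measure Ω) (Y : Set (Vec d')) (gx : Vec d → Vec d' → Vec d)
    (gy : Vec d → Vec d' → Vec d') (Gx : Vec d → Vec d' → Ξ → Vec d)
    (Gy : Vec d → Vec d' → Ξ → Vec d') (σ : ℝ) (s : ℕ → Ω → Ξ) : Prop where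
  measurable_x : Measurable fun q : Pt d d' × Ξ => Gx q.1.1 q.1.2 q.2
  measurable_y : Measurable fun q : Pt d d' × Ξ => Gy q.1.1 q.1.2 q.2
  unbiased : ∀ t x, ∀ y ∈ Y, IsUnbiasedWithVariance Pr (s t) (Gx x y) (gx x y) σ ∧
    IsUnbiasedWithVariance Pr (s t) (Gy x y) (gy x y) σ

omit [MeasurableSpace Ξ] in
theorem isCenteredNoise_oracleNoise [IsProbabilityMeasure Pr] {n : ℕ} {Y : Set (Vec d')}
    {G : Vec d → Vec d' → Ξ → Vec n} {g : Vec d → Vec d' → Vec n} {ξ : Ω → Ξ} {σ : ℝ}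
    (hproj : ∀ y, proj Y y ∈ Y)
    (h : ∀ x, ∀ y ∈ Y, IsUnbiasedWithVariance Pr ξ (G x y) (g x y) σ) :
    IsCenteredNoise Pr ξ (oracleNoise Y G g) σ where
  integrable z := (h z.1 _ (hproj z.2)).1.sub (integrable_const (g z.1 (proj Y z.2)))
  mean z := by
    obtain ⟨h1, h2, -, -⟩ := h z.1 _ (hproj z.2)
    simp only [oracleNoise]
    rw [integral_sub h1 (integrable_const _), h2]
    simp
  sq_integrable z := (h z.1 _ (hproj z.2)).2.2.1
  variance z := (h z.1 _ (hproj z.2)).2.2.2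

section ErrorExpectation

variable [IsProbabilityMeasure Pr] {ℱ : ℕ → MeasurableSpace Ω} {s : ℕ → Ω → Ξ} {σ : ℝ}
  {NX : Pt d d' × Ξ → Vec d} {NY : Pt d d' × Ξ → Vec d'} {Z : ℕ → Ω → Pt d d'}

theorem integral_epochError (hs : IsSampleStream Pr ℱ s) (hX : Measurable NX) (hY : Measurable NY)
    (hNX : ∀ t, IsCenteredNoise Pr (s t) NX σ) (hNY : ∀ t, IsCenteredNoise Pr (s t) NY σ)
    (hZ : ∀ t, Measurable[ℱ t] (Z t)) (hZ2 : ∀ t, IsL2 Pr (Z t)) (η : ℝ) (T : ℕ) :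
    Integrable (fun ω => epochError η T (fun t => Z t ω)
      (fun t => (NX (Z t ω, s t ω), -NY (Z t ω, s t ω)))) Pr ∧
    ∫ ω, epochError η T (fun t => Z t ω)
      (fun t => (NX (Z t ω, s t ω), -NY (Z t ω, s t ω))) ∂Pr ≤ 16 * η ^ 2 * T * σ ^ 2 := by
  set ζ : ℕ → Ω → Pt d d' := fun t ω => (NX (Z t ω, s t ω), -NY (Z t ω, s t ω)) with hζ
  have hvar : ∀ t, Integrable (fun ω => sqNorm (ζ t ω)) Pr ∧
      ∫ ω, sqNorm (ζ t ω) ∂Pr ≤ 2 * σ ^ 2 := by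
    intro t
    obtain ⟨a1, a2⟩ := hs.noise_memLp hX hNX hZ t
    obtain ⟨b1, b2⟩ := hs.noise_memLp hY hNY hZ t
    have i1 := MemLp.integrable_norm_sq' a1
    have i2 := MemLp.integrable_norm_sq' b1
    simp only [hζ, sqNorm, norm_neg]
    refine ⟨i1.add i2, ?_⟩
    rw [integral_add i1 i2]
    linarith
  -- `Z (t+1) - Z 0` is known before the sample `s (t+1)` is drawn, so the term is centered.
  have hdot : ∀ t, Integrable (fun ω => dot (ζ (t + 1) ω) (Z (t + 1) ω - Z 0 ω)) Pr ∧
      ∫ ω, dot (ζ (t + 1) ω) (Z (t + 1) ω - Z 0 ω) ∂Pr = 0 := by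
    intro t
    have hB : Measurable[ℱ (t + 1)] fun ω => Z (t + 1) ω - Z 0 ω :=
      (hZ (t + 1)).sub ((hZ 0).mono (hs.mono (Nat.zero_le _)) le_rfl)
    have hB2 := (hZ2 (t + 1)).sub (hZ2 0)
    have i1 := MemLp.integrable_inner_vec (hs.noise_memLp hX hNX hZ (t + 1)).1 hB2.1
    have i2 := MemLp.integrable_inner_vec (hs.noise_memLp hY hNY hZ (t + 1)).1 hB2.2
    have e1 := hs.integral_noise_inner hX hNX hZ (t + 1) (measurable_fst.comp hB) hB2.1
    have e2 := hs.integral_noise_inner hY hNY hZ (t + 1) (measurable_snd.comp hB) hB2.2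
    simp only [hζ, dot, inner_neg_left]
    have i3 := i2.neg
    refine ⟨i1.add i3, ?_⟩
    rw [integral_add (by exact i1) (by exact i3), integral_neg]
    simp only [Function.comp] at e1 e2
    rw [e1, e2]; simp
  have hsum : Integrable (fun ω => sqNorm (∑ t ∈ Finset.range T, ζ (t + 1) ω)) Pr ∧
      ∫ ω, sqNorm (∑ t ∈ Finset.range T, ζ (t + 1) ω) ∂Pr ≤ 2 * (T * σ ^ 2) := by
    obtain ⟨-, a1, a2⟩ := hs.noise_sum hX hNX hZ T
    obtain ⟨-, b1, b2⟩ := hs.noise_sum hY hNY hZ T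
    have i1 := MemLp.integrable_norm_sq' a1
    have i2 := MemLp.integrable_norm_sq' b1
    simp only [hζ, sqNorm, Prod.fst_sum, Prod.snd_sum, Finset.sum_neg_distrib, norm_neg]
    refine ⟨i1.add i2, ?_⟩
    rw [integral_add i1 i2]
    linarith
  have i1 : Integrable (fun ω => 3 * η ^ 2 * ∑ t ∈ Finset.range T,
      (sqNorm (ζ (t + 1) ω) + sqNorm (ζ t ω))) Pr :=
    (integrable_finsetSum _ fun t _ => (hvar (t + 1)).1.add (hvar t).1).const_mul _
  have i2 : Integrable (fun ω => η * ∑ t ∈ Finset.range T,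
      dot (ζ (t + 1) ω) (Z (t + 1) ω - Z 0 ω)) Pr :=
    (integrable_finsetSum _ fun t _ => (hdot t).1).const_mul _
  have i3 := hsum.1.const_mul (2 * η ^ 2)
  change Integrable (fun ω => 3 * η ^ 2 * ∑ t ∈ Finset.range T,
      (sqNorm (ζ (t + 1) ω) + sqNorm (ζ t ω)) - η * ∑ t ∈ Finset.range T,
      dot (ζ (t + 1) ω) (Z (t + 1) ω - Z 0 ω)
      + 2 * η ^ 2 * sqNorm (∑ t ∈ Finset.range T, ζ (t + 1) ω)) Pr ∧
    ∫ ω, (3 * η ^ 2 * ∑ t ∈ Finset.range T,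
      (sqNorm (ζ (t + 1) ω) + sqNorm (ζ t ω)) - η * ∑ t ∈ Finset.range T,
      dot (ζ (t + 1) ω) (Z (t + 1) ω - Z 0 ω)
      + 2 * η ^ 2 * sqNorm (∑ t ∈ Finset.range T, ζ (t + 1) ω)) ∂Pr ≤ _
  refine ⟨(i1.sub i2).add i3, ?_⟩
  rw [integral_add (by exact i1.sub i2) i3, integral_sub i1 i2, integral_const_mul,
    integral_const_mul, integral_const_mul,
    integral_finsetSum _ fun t _ => by exact (hvar (t + 1)).1.add (hvar t).1,
    integral_finsetSum _ fun t _ => (hdot t).1]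
  have e2 : ∑ t ∈ Finset.range T, ∫ ω, dot (ζ (t + 1) ω) (Z (t + 1) ω - Z 0 ω) ∂Pr = 0 :=
    Finset.sum_eq_zero fun t _ => (hdot t).2
  have e1 : ∑ t ∈ Finset.range T, ∫ ω, (sqNorm (ζ (t + 1) ω) + sqNorm (ζ t ω)) ∂Pr
      ≤ T * (4 * σ ^ 2) := by
    have : ∀ t ∈ Finset.range T, ∫ ω, (sqNorm (ζ (t + 1) ω) + sqNorm (ζ t ω)) ∂Pr
        ≤ 4 * σ ^ 2 := fun t _ => by
      rw [integral_add (hvar (t + 1)).1 (hvar t).1]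
      linarith [(hvar (t + 1)).2, (hvar t).2]
    simpa using Finset.sum_le_sum this
  rw [e2]
  -- The constant is `3·4 + 2·2 = 16`.
  have m1 := mul_le_mul_of_nonneg_left e1 (sq_nonneg η)
  have m2 := mul_le_mul_of_nonneg_left hsum.2 (sq_nonneg η)
  linarith

end ErrorExpectation

namespace RegularGame

variable {ℓ μ μx μy L ρ γ : ℝ} {Y : Set (Vec d')} {f : Vec d → Vec d' → ℝ}
  {gx : Vec d → Vec d' → Vec d} {gy : Vec d → Vec d' → Vec d'}

theorem proj_mem (H : RegularGame ℓ μ μx μy L ρ γ Y f gx gy) (y : Vec d') : proj Y y ∈ Y :=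
  (isProj_proj H.closed H.convex H.nonempty y).1

theorem proj_eq (H : RegularGame ℓ μ μx μy L ρ γ Y f gx gy) {y : Vec d'} (hy : y ∈ Y) :
    proj Y y = y := proj_eq_self H.closed H.convex hy

theorem norm_proj_sub_le (H : RegularGame ℓ μ μx μy L ρ γ Y f gx gy) (y y' : Vec d') :
    ‖proj Y y - proj Y y'‖ ≤ ‖y - y'‖ :=
  (isProj_proj H.closed H.convex H.nonempty y).norm_sub_le
    (isProj_proj H.closed H.convex H.nonempty y')

theorem continuous_proj (H : RegularGame ℓ μ μx μy L ρ γ Y f gx gy) : Continuous (proj Y) :=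
  PES.continuous_proj H.closed H.convex H.nonempty

/-- Composing with the projection extends the gradients to the whole space, which gives continuity,
hence measurability, and linear growth. -/
theorem grad_lipschitz (H : RegularGame ℓ μ μx μy L ρ γ Y f gx gy) (z w : Pt d d') :
    ‖gx z.1 (proj Y z.2) - gx w.1 (proj Y w.2)‖ ≤ ℓ * (‖z.1 - w.1‖ + ‖z.2 - w.2‖) ∧
    ‖gy z.1 (proj Y z.2) - gy w.1 (proj Y w.2)‖ ≤ ℓ * (‖z.1 - w.1‖ + ‖z.2 - w.2‖) := by
  have h1 := H.lip z.1 w.1 _ (H.proj_mem z.2) _ (H.proj_mem w.2)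
  have h2 := H.norm_proj_sub_le z.2 w.2
  have h3 : ‖proj Y z.2 - proj Y w.2‖ ^ 2 ≤ ‖z.2 - w.2‖ ^ 2 := by gcongr
  have h4 : ℓ ^ 2 * (‖z.1 - w.1‖ ^ 2 + ‖proj Y z.2 - proj Y w.2‖ ^ 2)
      ≤ (ℓ * (‖z.1 - w.1‖ + ‖z.2 - w.2‖)) ^ 2 := by
    rw [mul_pow]
    gcongr
    have := mul_nonneg (norm_nonneg (z.1 - w.1)) (norm_nonneg (z.2 - w.2))
    linarith
  have h5 := H.ℓ_pos
  constructor
  · exact (abs_le_of_sq_le_sq' (by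
      linarith [sq_nonneg ‖gy z.1 (proj Y z.2) - gy w.1 (proj Y w.2)‖]) (by positivity)).2
  · exact (abs_le_of_sq_le_sq' (by
      linarith [sq_nonneg ‖gx z.1 (proj Y z.2) - gx w.1 (proj Y w.2)‖]) (by positivity)).2

theorem continuous_of_sum_lipschitz {n : ℕ} {ℓ : ℝ} (hℓ : 0 ≤ ℓ) {h : Pt d d' → Vec n}
    (hh : ∀ z w : Pt d d', ‖h z - h w‖ ≤ ℓ * (‖z.1 - w.1‖ + ‖z.2 - w.2‖)) : Continuous h := by
  refine (LipschitzWith.of_dist_le_mul (K := (2 * ℓ).toNNReal) fun z w => ?_).continuous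
  rw [dist_eq_norm, Real.coe_toNNReal _ (by positivity), dist_eq_norm]
  have h1 := norm_fst_le (z - w)
  have h2 := norm_snd_le (z - w)
  rw [Prod.fst_sub] at h1
  rw [Prod.snd_sub] at h2
  have := mul_le_mul_of_nonneg_left (add_le_add h1 h2) hℓ
  linarith [hh z w]

theorem continuous_gx (H : RegularGame ℓ μ μx μy L ρ γ Y f gx gy) :
    Continuous fun z : Pt d d' => gx z.1 (proj Y z.2) :=
  continuous_of_sum_lipschitz H.ℓ_pos.le fun z w => (H.grad_lipschitz z w).1

theorem continuous_gy (H : RegularGame ℓ μ μx μy L ρ γ Y f gx gy) :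
    Continuous fun z : Pt d d' => gy z.1 (proj Y z.2) :=
  continuous_of_sum_lipschitz H.ℓ_pos.le fun z w => (H.grad_lipschitz z w).2

section Measurability

variable {Gx : Vec d → Vec d' → Ξ → Vec d} {Gy : Vec d → Vec d' → Ξ → Vec d'} {σ : ℝ}
  {s : ℕ → Ω → Ξ}

theorem measurable_noise_x (H : RegularGame ℓ μ μx μy L ρ γ Y f gx gy)
    (hO : IsOracle Pr Y gx gy Gx Gy σ s) : Measurable (oracleNoise Y Gx gx) := by
  have hp := H.continuous_proj.measurable
  exact (hO.measurable_x.comp (by fun_prop : Measurable fun q : Pt d d' × Ξ =>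
    ((q.1.1, proj Y q.1.2), q.2))).sub (H.continuous_gx.measurable.comp measurable_fst)

theorem measurable_noise_y (H : RegularGame ℓ μ μx μy L ρ γ Y f gx gy)
    (hO : IsOracle Pr Y gx gy Gx Gy σ s) : Measurable (oracleNoise Y Gy gy) := by
  have hp := H.continuous_proj.measurable
  exact (hO.measurable_y.comp (by fun_prop : Measurable fun q : Pt d d' × Ξ =>
    ((q.1.1, proj Y q.1.2), q.2))).sub (H.continuous_gy.measurable.comp measurable_fst)

/-- Stochastic gradients at a square-integrable past point are square-integrable. -/
theorem memLp_oracle [IsProbabilityMeasure Pr] (H : RegularGame ℓ μ μx μy L ρ γ Y f gx gy)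
    (hO : IsOracle Pr Y gx gy Gx Gy σ s) {t : ℕ} (hst : Measurable (s t)) {Z : Ω → Pt d d'}
    (hZ : Measurable Z) (hZ2 : IsL2 Pr Z) (hZY : ∀ ω, (Z ω).2 ∈ Y) (hind : IndepFun Z (s t) Pr) :
    MemLp (fun ω => Gx (Z ω).1 (Z ω).2 (s t ω)) 2 Pr ∧
    MemLp (fun ω => Gy (Z ω).1 (Z ω).2 (s t ω)) 2 Pr := by
  have a1 := ((isCenteredNoise_oracleNoise H.proj_mem fun x y hy =>
    (hO.unbiased t x y hy).1).memLp (H.measurable_noise_x hO) hst hZ hind).1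
  have a2 := ((isCenteredNoise_oracleNoise H.proj_mem fun x y hy =>
    (hO.unbiased t x y hy).2).memLp (H.measurable_noise_y hO) hst hZ hind).1
  have b1 : MemLp (fun ω => gx (Z ω).1 (proj Y (Z ω).2)) 2 Pr :=
    hZ2.memLp_of_growth (a := ‖gx 0 (proj Y 0)‖) (b := ℓ)
      (H.continuous_gx.measurable.comp hZ).aestronglyMeasurable fun ω => by
        have h1 := (H.grad_lipschitz (Z ω) 0).1
        have h2 := norm_sub_norm_le (gx (Z ω).1 (proj Y (Z ω).2)) (gx 0 (proj Y 0))
        simp only [Prod.fst_zero, Prod.snd_zero, sub_zero] at h1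
        linarith
  have b2 : MemLp (fun ω => gy (Z ω).1 (proj Y (Z ω).2)) 2 Pr :=
    hZ2.memLp_of_growth (a := ‖gy 0 (proj Y 0)‖) (b := ℓ)
      (H.continuous_gy.measurable.comp hZ).aestronglyMeasurable fun ω => by
        have h1 := (H.grad_lipschitz (Z ω) 0).2
        have h2 := norm_sub_norm_le (gy (Z ω).1 (proj Y (Z ω).2)) (gy 0 (proj Y 0))
        simp only [Prod.fst_zero, Prod.snd_zero, sub_zero] at h1
        linarith
  have c1 := a1.add b1
  have c2 := a2.add b2
  refine ⟨(memLp_congr_ae (Filter.Eventually.of_forall fun ω => ?_)).1 c1,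
    (memLp_congr_ae (Filter.Eventually.of_forall fun ω => ?_)).1 c2⟩ <;>
  simp [oracleNoise, H.proj_eq (hZY ω)]

end Measurability
end RegularGame
end Epoch
end PES

/-! ### Adapted square-integrable iterates and one epoch in expectation -/

namespace PES

section Epoch

variable {d d' : ℕ} {Ξ Ω : Type*} [MeasurableSpace Ξ] {mΩ : MeasurableSpace Ω} {Pr : Measure Ω}

namespace RegularGame

variable {ℓ μ μx μy L ρ γ : ℝ} {Y : Set (Vec d')} {f : Vec d → Vec d' → ℝ}
  {gx : Vec d → Vec d' → Vec d} {gy : Vec d → Vec d' → Vec d'}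

section Measurability

variable {Gx : Vec d → Vec d' → Ξ → Vec d} {Gy : Vec d → Vec d' → Ξ → Vec d'} {σ : ℝ}
  {s : ℕ → Ω → Ξ}

theorem measurable_prox_step (H : RegularGame ℓ μ μx μy L ρ γ Y f gx gy)
    (hO : IsOracle Pr Y gx gy Gx Gy σ s) {m : MeasurableSpace Ω} {B Z W : Ω → Pt d d'}
    {x : Ω → Ξ} (hB : Measurable[m] B) (hZ : Measurable[m] Z) (hW : Measurable[m] W)
    (hx : Measurable[m] x) (η : ℝ) :
    Measurable[m] fun ω => prox Y (B ω) (η • regField Gx Gy γ (W ω).1 (Z ω) (x ω)) := by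
  simp only [prox_eq H.closed H.convex H.nonempty, regField, Prod.smul_fst, Prod.smul_snd]
  have h1 : Measurable[m] fun ω => Gx (Z ω).1 (Z ω).2 (x ω) := hO.measurable_x.comp (hZ.prodMk hx)
  have h2 : Measurable[m] fun ω => Gy (Z ω).1 (Z ω).2 (x ω) := hO.measurable_y.comp (hZ.prodMk hx)
  have hp := H.continuous_proj.measurable
  have hγ : Measurable[m] fun ω => γ • ((Z ω).1 - (W ω).1) :=
    ((measurable_fst.comp hZ).sub (measurable_fst.comp hW)).const_smul γ
  exact Measurable.prodMk ((measurable_fst.comp hB).sub ((h1.add hγ).const_smul η))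
    (hp.comp ((measurable_snd.comp hB).sub (h2.neg.const_smul η)))

omit [MeasurableSpace Ξ] in
theorem isL2_prox_step [IsProbabilityMeasure Pr] (H : RegularGame ℓ μ μx μy L ρ γ Y f gx gy)
    {B Z W : Ω → Pt d d'} {x : Ω → Ξ} (hB : IsL2 Pr B) (hZ : IsL2 Pr Z) (hW : IsL2 Pr W)
    (hGx : MemLp (fun ω => Gx (Z ω).1 (Z ω).2 (x ω)) 2 Pr)
    (hGy : MemLp (fun ω => Gy (Z ω).1 (Z ω).2 (x ω)) 2 Pr) (η : ℝ) :
    IsL2 Pr fun ω => prox Y (B ω) (η • regField Gx Gy γ (W ω).1 (Z ω) (x ω)) := by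
  have e : (fun ω => prox Y (B ω) (η • regField Gx Gy γ (W ω).1 (Z ω) (x ω)))
      = fun ω => ((B ω).1 - η • (Gx (Z ω).1 (Z ω).2 (x ω) + γ • ((Z ω).1 - (W ω).1)),
        proj Y ((B ω).2 - η • -Gy (Z ω).1 (Z ω).2 (x ω))) :=
    funext fun ω => prox_eq H.closed H.convex H.nonempty _ _
  rw [e]
  have h0 : MemLp (fun ω => γ • ((Z ω).1 - (W ω).1)) 2 Pr := (hZ.1.sub hW.1).const_smul γ
  have h0' : MemLp (fun ω => η • (Gx (Z ω).1 (Z ω).2 (x ω) + γ • ((Z ω).1 - (W ω).1))) 2 Pr :=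
    (hGx.add h0).const_smul η
  refine ⟨hB.1.sub h0', ?_⟩
  have h1 : MemLp (fun ω => (B ω).2 - η • -Gy (Z ω).1 (Z ω).2 (x ω)) 2 Pr :=
    hB.2.sub (hGy.neg.const_smul η)
  set U : Ω → Vec d' := fun ω => (B ω).2 - η • -Gy (Z ω).1 (Z ω).2 (x ω)
  have h4 : AEStronglyMeasurable (fun ω => proj Y (U ω)) Pr :=
    H.continuous_proj.comp_aestronglyMeasurable h1.1
  have h5 : MemLp (fun ω => ‖proj Y 0‖ + ‖U ω‖) 2 Pr := (memLp_const ‖proj Y 0‖).add h1.norm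
  refine h5.mono' h4 (Filter.Eventually.of_forall fun ω => ?_)
  have h2 := H.norm_proj_sub_le (U ω) 0
  have h3 := norm_sub_norm_le (proj Y (U ω)) (proj Y 0)
  rw [sub_zero] at h2
  linarith

variable [IsProbabilityMeasure Pr] {ℱ : ℕ → MeasurableSpace Ω} {Z₀ : Ω → Pt d d'}

/-- The two sequences live at different times: `z_t` uses only samples before `s t`, whereas `z̃_t`
has already used `s t`. -/
theorem ogda_iterates (H : RegularGame ℓ μ μx μy L ρ γ Y f gx gy)
    (hO : IsOracle Pr Y gx gy Gx Gy σ s) (hs : IsSampleStream Pr ℱ s)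
    (hZ : Measurable[ℱ 0] Z₀) (hZ2 : IsL2 Pr Z₀) (hZY : ∀ ω, (Z₀ ω).2 ∈ Y) (η : ℝ) (t : ℕ) :
    (Measurable[ℱ t] fun ω =>
      (ogda Y (regField Gx Gy γ (Z₀ ω).1) η (fun t => s t ω) (Z₀ ω) t).1) ∧
    (Measurable[ℱ (t + 1)] fun ω =>
      (ogda Y (regField Gx Gy γ (Z₀ ω).1) η (fun t => s t ω) (Z₀ ω) t).2) ∧
    (IsL2 Pr fun ω => (ogda Y (regField Gx Gy γ (Z₀ ω).1) η (fun t => s t ω) (Z₀ ω) t).1) ∧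
    (IsL2 Pr fun ω => (ogda Y (regField Gx Gy γ (Z₀ ω).1) η (fun t => s t ω) (Z₀ ω) t).2) := by
  induction t with
  | zero => exact ⟨hZ, hZ.mono (hs.mono (Nat.zero_le _)) le_rfl, hZ2, hZ2⟩
  | succ t ih =>
    set o := fun ω => ogda Y (regField Gx Gy γ (Z₀ ω).1) η (fun t => s t ω) (Z₀ ω) t with ho
    obtain ⟨ih1, ih2, ih3, ih4⟩ := ih
    have hZt : Measurable[ℱ (t + 1)] Z₀ := hZ.mono (hs.mono (Nat.zero_le _)) le_rfl
    have hg := H.memLp_oracle (Z := fun ω => (o ω).1) hO ((hs.measurable t).mono (hs.le _) le_rfl)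
      (ih1.mono (hs.le _) le_rfl) ih3 (fun ω => (ogda_mem H.closed H.convex (hZY ω) t).1)
      (indepFun_of_measurable (hs.indep t) ih1)
    have m1 := H.measurable_prox_step hO ih2 (ih1.mono (hs.mono t.le_succ) le_rfl) hZt
      (hs.measurable t) η
    have l1 := H.isL2_prox_step ih4 ih3 hZ2 hg.1 hg.2 η
    set z' : Ω → Pt d d' := fun ω => prox Y (o ω).2 (η • regField Gx Gy γ (Z₀ ω).1 (o ω).1 (s t ω))
    have hz' : ∀ ω, (z' ω).2 ∈ Y := fun ω => by
      simp only [z', prox_eq H.closed H.convex H.nonempty]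
      exact H.proj_mem _
    have hg' := H.memLp_oracle (Z := z') hO ((hs.measurable (t + 1)).mono (hs.le _) le_rfl)
      (m1.mono (hs.le _) le_rfl) l1 hz' (indepFun_of_measurable (hs.indep (t + 1)) m1)
    have hle : ℱ (t + 1) ≤ ℱ (t + 1 + 1) := hs.mono (Nat.le_succ _)
    have m2 := H.measurable_prox_step hO (ih2.mono hle le_rfl) (m1.mono hle le_rfl)
      (hZt.mono hle le_rfl) (hs.measurable (t + 1)) η
    have l2 := H.isL2_prox_step ih4 l1 hZ2 hg'.1 hg'.2 η
    exact ⟨m1, m2, l1, l2⟩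

/-- An infimum of continuous functions; this gives measurability with no selection of minimizers.
The case `c = 0` covers `dual`. -/
theorem upperSemicontinuous_proxDual (H : RegularGame ℓ μ μx μy L ρ γ Y f gx gy) {c : ℝ}
    (hc : 0 ≤ c) : UpperSemicontinuous fun q : Vec d × Vec d' =>
      proxDual f c q.1 (proj Y q.2) := by
  refine upperSemicontinuous_ciInf (f := fun x (q : Vec d × Vec d') =>
    f x (proj Y q.2) + c / 2 * ‖x - q.1‖ ^ 2) (fun q => ⟨dual f (proj Y q.2), ?_⟩) fun x => ?_
  · rintro _ ⟨x, rfl⟩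
    have := H.dual_le x (H.proj_mem q.2)
    have := mul_nonneg hc (sq_nonneg ‖x - q.1‖)
    dsimp only
    linarith
  · have h1 : ContinuousOn (fun y => f x y) Y := fun y hy => (H.grad x y hy).2.continuousWithinAt
    have h2 : Continuous fun q : Vec d × Vec d' => f x (proj Y q.2) :=
      h1.comp_continuous (H.continuous_proj.comp continuous_snd) fun q => H.proj_mem q.2
    exact (h2.add (by fun_prop : Continuous fun q : Vec d × Vec d' =>
      c / 2 * ‖x - q.1‖ ^ 2)).upperSemicontinuous

theorem measurable_proxDual (H : RegularGame ℓ μ μx μy L ρ γ Y f gx gy) {c : ℝ}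
    (hc : 0 ≤ c) {W Z : Ω → Pt d d'} (hW : Measurable W) (hZ : Measurable Z) :
    Measurable fun ω => proxDual f c (W ω).1 (proj Y (Z ω).2) := by
  have h1 : Measurable fun q : Vec d × Vec d' => proxDual f c q.1 (proj Y q.2) :=
    (H.upperSemicontinuous_proxDual hc).measurable
  have h2 : Measurable fun ω => ((W ω).1, (Z ω).2) :=
    (measurable_fst.comp hW).prodMk (measurable_snd.comp hZ)
  simpa only [Function.comp_def] using h1.comp h2

theorem integrable_gap (H : RegularGame ℓ μ μx μy L ρ γ Y f gx gy) {Z : Ω → Pt d d'}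
    (hZ : Measurable Z) (hZ2 : IsL2 Pr Z) (hZY : ∀ ω, (Z ω).2 ∈ Y) :
    Integrable (fun ω => gap Y f (Z ω)) Pr := by
  obtain ⟨C, -, hC⟩ := H.gap_le_sq
  refine Integrable.mono' (g := fun ω => C * (1 + ‖(Z ω).1‖ ^ 2 + ‖(Z ω).2‖ ^ 2)) ?_ ?_
    (Filter.Eventually.of_forall fun ω => ?_)
  · have h1 : Integrable (fun ω => 1 + ‖(Z ω).1‖ ^ 2) Pr :=
      (integrable_const (1 : ℝ)).add (MemLp.integrable_norm_sq' hZ2.1)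
    have h2 : Integrable (fun ω => 1 + ‖(Z ω).1‖ ^ 2 + ‖(Z ω).2‖ ^ 2) Pr :=
      h1.add (MemLp.integrable_norm_sq' hZ2.2)
    exact h2.const_mul C
  · have h1 : Measurable fun ω => primal Y f (Z ω).1 :=
      H.smooth.1.continuous.measurable.comp (measurable_fst.comp hZ)
    have h2 : Measurable fun ω => proxDual f 0 (Z ω).1 (proj Y (Z ω).2) :=
      H.measurable_proxDual le_rfl hZ hZ
    have e : (fun ω => gap Y f (Z ω))
        = fun ω => primal Y f (Z ω).1 - proxDual f 0 (Z ω).1 (proj Y (Z ω).2) :=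
      funext fun ω => by simp [gap, dual, proxDual, H.proj_eq (hZY ω)]
    rw [e]
    exact (h1.sub h2).aestronglyMeasurable
  · rw [Real.norm_of_nonneg (H.gap_nonneg (hZY ω))]
    exact hC _ (hZY ω)

theorem integrable_proxGap (H : RegularGame ℓ μ μx μy L ρ γ Y f gx gy) {Z W : Ω → Pt d d'}
    (hZ : Measurable Z) (hZ2 : IsL2 Pr Z) (hZY : ∀ ω, (Z ω).2 ∈ Y) (hW : Measurable W)
    (hW2 : IsL2 Pr W) : Integrable (fun ω => proxGap Y f γ (W ω).1 (Z ω)) Pr := by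
  have hsq : Integrable (fun ω => γ / 2 * ‖(Z ω).1 - (W ω).1‖ ^ 2) Pr :=
    (MemLp.integrable_norm_sq' (hZ2.1.sub hW2.1)).const_mul _
  refine Integrable.mono' ((H.integrable_gap hZ hZ2 hZY).add hsq) ?_
    (Filter.Eventually.of_forall fun ω => ?_)
  · have h1 : Measurable fun ω => primal Y f (Z ω).1 :=
      H.smooth.1.continuous.measurable.comp (measurable_fst.comp hZ)
    have h2 : Measurable fun ω => proxDual f γ (W ω).1 (proj Y (Z ω).2) :=
      H.measurable_proxDual H.γ_pos.le hW hZ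
    have h3 : Measurable fun ω => γ / 2 * ‖(Z ω).1 - (W ω).1‖ ^ 2 := by fun_prop
    have e : (fun ω => proxGap Y f γ (W ω).1 (Z ω)) = fun ω =>
        primal Y f (Z ω).1 + γ / 2 * ‖(Z ω).1 - (W ω).1‖ ^ 2
          - proxDual f γ (W ω).1 (proj Y (Z ω).2) :=
      funext fun ω => by simp [proxGap, H.proj_eq (hZY ω)]
    rw [e]
    exact ((h1.add h3).sub h2).aestronglyMeasurable
  · rw [Real.norm_of_nonneg (H.proxGap_nonneg _ (hZY ω))]
    exact H.proxGap_le_gap _ (hZY ω)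

/-- One epoch of the method in expectation. -/
theorem epoch_expectation (H : RegularGame ℓ μ μx μy L ρ γ Y f gx gy) {lam : ℝ} (hlam : 0 < lam)
    (hγ : lam ≤ γ / 2) (hμy : lam ≤ μy) {η : ℝ} (hη : 0 < η) (hηℓ : 240 * (η ^ 2 * ℓ ^ 2) ≤ 1)
    {T : ℕ} (hT : 384 ≤ lam * (η * T)) (hO : IsOracle Pr Y gx gy Gx Gy σ s)
    (hs : IsSampleStream Pr ℱ s) (hZ : Measurable[ℱ 0] Z₀) (hZ2 : IsL2 Pr Z₀)
    (hZY : ∀ ω, (Z₀ ω).2 ∈ Y) {A : Ω → Pt d d'}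
    (hA : ∀ ω, A ω = ogdaAverage Y (regField Gx Gy γ (Z₀ ω).1) η T (fun t => s t ω) (Z₀ ω)) :
    (∀ ω, (A ω).2 ∈ Y) ∧ Measurable[ℱ T] A ∧ IsL2 Pr A ∧
    ∫ ω, proxGap Y f γ (Z₀ ω).1 (A ω) ∂Pr
      ≤ (∫ ω, proxGap Y f γ (Z₀ ω).1 (Z₀ ω) ∂Pr) / 150 + 17 * η * σ ^ 2 := by
  have hT0 : 0 < T := by
    rcases Nat.eq_zero_or_pos T with h | h
    · rw [h] at hT; norm_num at hT
    · exact h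
  set z : ℕ → Ω → Pt d d' := fun t ω =>
    (ogda Y (regField Gx Gy γ (Z₀ ω).1) η (fun t => s t ω) (Z₀ ω) t).1 with hz
  set ζ : ℕ → Ω → Pt d d' := fun t ω =>
    (oracleNoise Y Gx gx (z t ω, s t ω), -oracleNoise Y Gy gy (z t ω, s t ω)) with hζ
  have hit := H.ogda_iterates hO hs hZ hZ2 hZY η
  have hzY : ∀ t ω, (z t ω).2 ∈ Y := fun t ω => (ogda_mem H.closed H.convex (hZY ω) t).1
  have hpath := fun ω => H.epoch_pathwise hlam hγ hμy hη hηℓ hT0 (Gx := Gx) (Gy := Gy)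
    (s := fun t => s t ω) (hZY ω) (fun t => z t ω) (fun t => ζ t ω) (fun t => rfl) (fun t => by
      simp only [hζ, regField, meanField, oracleNoise, H.proj_eq (hzY t ω), Prod.mk_add_mk]
      congr 1 <;> abel)
  simp only [← hA] at hpath
  have hAY : ∀ ω, (A ω).2 ∈ Y := fun ω => (hpath ω).1
  have hAsum : A = fun ω => (1 / (T : ℝ)) • ∑ t ∈ Finset.Icc 1 T, z t ω :=
    funext fun ω => by rw [hA]; rfl
  have hAm : Measurable[ℱ T] A := by
    rw [hAsum]
    have h1 : Measurable[ℱ T] fun ω => ∑ t ∈ Finset.Icc 1 T, z t ω :=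
      Finset.measurable_sum _ fun t ht =>
        (hit t).1.mono (hs.mono (Finset.mem_Icc.1 ht).2) le_rfl
    exact h1.const_smul (1 / (T : ℝ))
  have hA2 : IsL2 Pr A := by
    rw [hAsum]
    simp only [IsL2, Prod.smul_fst, Prod.smul_snd, Prod.fst_sum, Prod.snd_sum]
    have h1 : MemLp (fun ω => ∑ t ∈ Finset.Icc 1 T, (z t ω).1) 2 Pr :=
      memLp_finsetSum _ fun t _ => (hit t).2.2.1.1
    have h2 : MemLp (fun ω => ∑ t ∈ Finset.Icc 1 T, (z t ω).2) 2 Pr :=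
      memLp_finsetSum _ fun t _ => (hit t).2.2.1.2
    exact ⟨h1.const_smul (1 / (T : ℝ)), h2.const_smul (1 / (T : ℝ))⟩
  refine ⟨hAY, hAm, hA2, ?_⟩
  have hZm : Measurable Z₀ := hZ.mono (hs.le _) le_rfl
  have i1 := H.integrable_proxGap (hAm.mono (hs.le _) le_rfl) hA2 hAY hZm hZ2
  have i2 := H.integrable_proxGap hZm hZ2 hZY hZm hZ2
  obtain ⟨i3, hE⟩ := integral_epochError hs (H.measurable_noise_x hO) (H.measurable_noise_y hO)
    (fun t => isCenteredNoise_oracleNoise H.proj_mem fun x y hy => (hO.unbiased t x y hy).1)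
    (fun t => isCenteredNoise_oracleNoise H.proj_mem fun x y hy => (hO.unbiased t x y hy).2)
    (fun t => (hit t).1) (fun t => (hit t).2.2.1) η T
  have hint := integral_mono (i1.const_mul (lam * (η * T)))
    (((i1.add i2).const_mul (5 / 2)).add (i3.const_mul lam)) fun ω => (hpath ω).2
  have e : ∫ ω, ((fun ω => 5 / 2 * (((fun ω => proxGap Y f γ (Z₀ ω).1 (A ω))
      + fun ω => proxGap Y f γ (Z₀ ω).1 (Z₀ ω)) ω)) + fun ω => lam * epochError η T
        (fun t => z t ω) (fun t => ζ t ω)) ω ∂Pr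
      = 5 / 2 * (∫ ω, proxGap Y f γ (Z₀ ω).1 (A ω) ∂Pr + ∫ ω, proxGap Y f γ (Z₀ ω).1 (Z₀ ω) ∂Pr)
        + lam * ∫ ω, epochError η T (fun t => z t ω) (fun t => ζ t ω) ∂Pr := by
    rw [integral_add' ((i1.add i2).const_mul (5 / 2)) (i3.const_mul lam), integral_const_mul,
      integral_add' i1 i2, integral_const_mul]
  rw [integral_const_mul] at hint
  replace hint := hint.trans_eq e
  have hG0 : 0 ≤ ∫ ω, proxGap Y f γ (Z₀ ω).1 (Z₀ ω) ∂Pr :=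
    integral_nonneg fun ω => H.proxGap_nonneg _ (hZY ω)
  set G := ∫ ω, proxGap Y f γ (Z₀ ω).1 (A ω) ∂Pr
  set G0 := ∫ ω, proxGap Y f γ (Z₀ ω).1 (Z₀ ω) ∂Pr
  have hE' := mul_le_mul_of_nonneg_left hE hlam.le
  set M := lam * (η * T) with hM
  have h1 : M * G ≤ 5 / 2 * (G + G0) + M * (16 * η * σ ^ 2) := by rw [hM]; linarith
  have hq : 0 ≤ η * σ ^ 2 := by positivity
  -- For `M ≥ 384`, `(5/2)/(M - 5/2) ≤ 1/150` and `16M/(M - 5/2) ≤ 17`.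
  by_contra! hcon
  have h2 := mul_lt_mul_of_pos_left hcon (show 0 < M - 5 / 2 by linarith)
  have h3 := mul_le_mul_of_nonneg_right hT hq
  have h4 := mul_le_mul_of_nonneg_right hT hG0
  linarith

end Measurability

end RegularGame

end Epoch

end PES

/-! ### Filtration of the samples and decay of the potential over epochs -/

namespace PES

section Samples

variable {Ξ Ω : Type*} [MeasurableSpace Ξ] {mΩ : MeasurableSpace Ω} {Pr : Measure Ω}

/-- The information revealed by the samples that precede `ξ k t` in the lexicographic order. -/
@[reducible]
def past (ξ : ℕ → ℕ → Ω → Ξ) (k t : ℕ) : MeasurableSpace Ω :=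
  ⨆ q ∈ {q : ℕ × ℕ | q.1 < k ∨ q.1 = k ∧ q.2 < t},
    MeasurableSpace.comap (ξ q.1 q.2) inferInstance

theorem past_le_past (ξ : ℕ → ℕ → Ω → Ξ) {k t k' t' : ℕ} (h : k < k' ∨ k = k' ∧ t ≤ t') :
    past ξ k t ≤ past ξ k' t' :=
  biSup_mono fun q hq => by
    rcases hq with hq | hq <;> rcases h with h | h
    · exact Or.inl (by omega)
    · exact Or.inl (by omega)
    · exact Or.inl (by omega)
    · exact Or.inr ⟨by omega, by omega⟩

/-- The past of `(k, t)` and the sample at `(k, t)` are generated by disjoint families of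
independent variables. -/
theorem isSampleStream_past {ξ : ℕ → ℕ → Ω → Ξ} (hm : ∀ k t, Measurable (ξ k t))
    (hind : iIndepFun (fun q : ℕ × ℕ => ξ q.1 q.2) Pr) (k : ℕ) :
    IsSampleStream Pr (past ξ k) (ξ k) where
  mono _ _ h := past_le_past ξ (Or.inr ⟨rfl, h⟩)
  le _ := iSup₂_le fun q _ => (hm q.1 q.2).comap_le
  measurable t := measurable_iff_comap_le.2 <|
    le_biSup (fun q : ℕ × ℕ => MeasurableSpace.comap (ξ q.1 q.2) inferInstance)
      (show (k, t) ∈ {q : ℕ × ℕ | q.1 < k ∨ q.1 = k ∧ q.2 < t + 1} from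
        Or.inr ⟨rfl, Nat.lt_succ_self t⟩)
  indep t := by
    have h := indep_iSup_of_disjoint (fun q : ℕ × ℕ => (hm q.1 q.2).comap_le) hind
      (S := {q : ℕ × ℕ | q.1 < k ∨ q.1 = k ∧ q.2 < t}) (T := {(k, t)})
      (Set.disjoint_singleton_right.2 fun h => by
        rcases h with h | h
        · exact lt_irrefl _ h
        · exact lt_irrefl _ h.2)
    rw [iSup_singleton] at h
    exact h

end Samples

namespace RegularGame

variable {d d' : ℕ} {Ξ Ω : Type*} [MeasurableSpace Ξ] {mΩ : MeasurableSpace Ω} {Pr : Measure Ω}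
  [IsProbabilityMeasure Pr]
  {ℓ μ μx μy L ρ γ : ℝ} {Y : Set (Vec d')} {f : Vec d → Vec d' → ℝ}
  {gx : Vec d → Vec d' → Vec d} {gy : Vec d → Vec d' → Vec d'}

theorem integrable_primal_sub (H : RegularGame ℓ μ μx μy L ρ γ Y f gx gy) {Z : Ω → Pt d d'}
    (hZ : Measurable Z) (hZ2 : IsL2 Pr Z) (hZY : ∀ ω, (Z ω).2 ∈ Y) :
    Integrable (fun ω => primal Y f (Z ω).1 - primalMin Y f) Pr := by
  have h1 : Measurable fun ω => primal Y f (Z ω).1 :=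
    H.smooth.1.continuous.measurable.comp (measurable_fst.comp hZ)
  refine (H.integrable_gap hZ hZ2 hZY).mono' (h1.sub_const _).aestronglyMeasurable
    (Filter.Eventually.of_forall fun ω => ?_)
  rw [Real.norm_of_nonneg (sub_nonneg.2 (H.primalMin_le _))]
  exact H.primal_sub_primalMin_le_gap _ (hZY ω)

variable {Gx : Vec d → Vec d' → Ξ → Vec d} {Gy : Vec d → Vec d' → Ξ → Vec d'} {σ : ℝ}
  {ξ : ℕ → ℕ → Ω → Ξ}

/-- The Lyapunov function of the proximal epoch method. -/
noncomputable def potential (Pr : Measure Ω) (Y : Set (Vec d')) (f : Vec d → Vec d' → ℝ) (γ : ℝ)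
    (Z : Ω → Pt d d') : ℝ :=
  ∫ ω, (primal Y f (Z ω).1 - primalMin Y f) ∂Pr
    + 1 / 16 * ∫ ω, proxGap Y f γ (Z ω).1 (Z ω) ∂Pr

omit [IsProbabilityMeasure Pr] in
theorem integral_proxGap_le_potential (H : RegularGame ℓ μ μx μy L ρ γ Y f gx gy)
    (Z : Ω → Pt d d') :
    ∫ ω, proxGap Y f γ (Z ω).1 (Z ω) ∂Pr ≤ 16 * potential Pr Y f γ Z := by
  have h : 0 ≤ ∫ ω, (primal Y f (Z ω).1 - primalMin Y f) ∂Pr :=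
    integral_nonneg fun ω => sub_nonneg.2 (H.primalMin_le _)
  simp only [potential]
  linarith

/-- One epoch contracts the potential. -/
theorem potential_epoch (H : RegularGame ℓ μ μx μy L ρ γ Y f gx gy) {lam : ℝ} (hlam : 0 < lam)
    (hγ : lam ≤ γ / 2) (hμy : lam ≤ μy) {η : ℝ} (hη : 0 < η) (hηℓ : 240 * (η ^ 2 * ℓ ^ 2) ≤ 1)
    {T : ℕ} (hT : 384 ≤ lam * (η * T)) {ℱ : ℕ → MeasurableSpace Ω} {s : ℕ → Ω → Ξ}
    {Z₀ : Ω → Pt d d'} (hO : IsOracle Pr Y gx gy Gx Gy σ s)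
    (hs : IsSampleStream Pr ℱ s) (hZ : Measurable[ℱ 0] Z₀) (hZ2 : IsL2 Pr Z₀)
    (hZY : ∀ ω, (Z₀ ω).2 ∈ Y) {A : Ω → Pt d d'}
    (hA : ∀ ω, A ω = ogdaAverage Y (regField Gx Gy γ (Z₀ ω).1) η T (fun t => s t ω) (Z₀ ω)) :
    (∀ ω, (A ω).2 ∈ Y) ∧ Measurable[ℱ T] A ∧ IsL2 Pr A ∧
    potential Pr Y f γ A ≤ 9 / 10 * potential Pr Y f γ Z₀ + 130 * η * σ ^ 2 := by
  obtain ⟨hAY, hAm, hA2, hE⟩ := H.epoch_expectation hlam hγ hμy hη hηℓ hT hO hs hZ hZ2 hZY hA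
  refine ⟨hAY, hAm, hA2, ?_⟩
  have hZm : Measurable Z₀ := hZ.mono (hs.le _) le_rfl
  have hAm' : Measurable A := hAm.mono (hs.le _) le_rfl
  have iG := H.integrable_proxGap hAm' hA2 hAY hZm hZ2
  have iP0 := H.integrable_primal_sub hZm hZ2 hZY
  have iPA := H.integrable_primal_sub hAm' hA2 hAY
  have iGA := H.integrable_proxGap hAm' hA2 hAY hAm' hA2
  have h1 := integral_mono iPA ((iP0.const_mul (2 / 5)).add (iG.const_mul 7))
    fun ω => H.primal_contraction (Z₀ ω).1 (hAY ω)
  have h2 := integral_mono iGA ((iG.const_mul 10).add (iP0.const_mul 8))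
    fun ω => H.proxGap_recenter (Z₀ ω).1 (hAY ω)
  rw [integral_add' (iP0.const_mul (2 / 5)) (iG.const_mul 7), integral_const_mul,
    integral_const_mul] at h1
  rw [integral_add' (iG.const_mul 10) (iP0.const_mul 8), integral_const_mul,
    integral_const_mul] at h2
  have h3 : 0 ≤ ∫ ω, proxGap Y f γ (Z₀ ω).1 (Z₀ ω) ∂Pr :=
    integral_nonneg fun ω => H.proxGap_nonneg _ (hZY ω)
  have h4 : 0 ≤ η * σ ^ 2 := by positivity
  -- Weight `1/16`: the primal coefficient is `2/5 + 8/16 = 9/10`. The gap coefficient is `7 + 10/16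
  -- = 61/8`, with `61/8 / 150 ≤ 9/10 · 1/16` and `17 · 61/8 ≤ 130`.
  simp only [potential]
  linarith

/-- Measurability, integrability and geometric decrease of the potential along the method. -/
theorem pes_potential (H : RegularGame ℓ μ μx μy L ρ γ Y f gx gy) {lam : ℝ} (hlam : 0 < lam)
    (hγ : lam ≤ γ / 2) (hμy : lam ≤ μy) {η : ℕ → ℝ} {T : ℕ → ℕ} (hη : ∀ k, 0 < η k)
    (hηℓ : ∀ k, 240 * (η (k + 1) ^ 2 * ℓ ^ 2) ≤ 1)
    (hT : ∀ k, 384 ≤ lam * (η (k + 1) * T (k + 1))) (hξ : ∀ k t, Measurable (ξ k t))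
    (hind : iIndepFun (fun q : ℕ × ℕ => ξ q.1 q.2) Pr)
    (hO : ∀ k, IsOracle Pr Y gx gy Gx Gy σ (ξ k)) {z₀ : Pt d d'} (h0 : z₀.2 ∈ Y) {A q : ℝ}
    (hA0 : 17 / 16 * gap Y f z₀ ≤ A)
    (hA : ∀ k, 9 / 10 * (A * q ^ k) + 130 * η (k + 1) * σ ^ 2 ≤ A * q ^ (k + 1)) (k : ℕ) :
    (∀ ω, (pes Y Gx Gy γ η T (fun k t => ξ k t ω) z₀ k).2 ∈ Y) ∧
    (Measurable[past ξ (k + 1) 0] fun ω => pes Y Gx Gy γ η T (fun k t => ξ k t ω) z₀ k) ∧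
    (IsL2 Pr fun ω => pes Y Gx Gy γ η T (fun k t => ξ k t ω) z₀ k) ∧
    potential Pr Y f γ (fun ω => pes Y Gx Gy γ η T (fun k t => ξ k t ω) z₀ k) ≤ A * q ^ k := by
  induction k with
  | zero =>
    refine ⟨fun _ => h0, measurable_const, ⟨memLp_const z₀.1, memLp_const z₀.2⟩, ?_⟩
    have h1 := H.primal_sub_primalMin_le_gap z₀.1 h0
    have h2 := H.proxGap_self_le_gap h0
    simp only [potential, pes, integral_const, probReal_univ, one_smul, pow_zero, mul_one]
    linarith
  | succ k ih =>
    obtain ⟨ih1, ih2, ih3, ih4⟩ := ih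
    obtain ⟨a1, a2, a3, a4⟩ := H.potential_epoch hlam hγ hμy (hη (k + 1)) (hηℓ k) (hT k)
      (hO (k + 1)) (isSampleStream_past hξ hind (k + 1)) ih2 ih3 ih1
      (A := fun ω => pes Y Gx Gy γ η T (fun k t => ξ k t ω) z₀ (k + 1)) (fun ω => rfl)
    refine ⟨a1, a2.mono (past_le_past ξ (Or.inl (Nat.lt_succ_self _))) le_rfl, a3, ?_⟩
    have := hA k
    linarith

/-- The expected duality gap along the method. -/
theorem pes_gap (H : RegularGame ℓ μ μx μy L ρ γ Y f gx gy) {lam : ℝ} (hlam : 0 < lam)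
    (hγ : lam ≤ γ / 2) (hμy : lam ≤ μy) {η : ℕ → ℝ} {T : ℕ → ℕ} (hη : ∀ k, 0 < η k)
    (hηℓ : ∀ k, 240 * (η (k + 1) ^ 2 * ℓ ^ 2) ≤ 1)
    (hT : ∀ k, 384 ≤ lam * (η (k + 1) * T (k + 1))) (hξ : ∀ k t, Measurable (ξ k t))
    (hind : iIndepFun (fun q : ℕ × ℕ => ξ q.1 q.2) Pr)
    (hO : ∀ k, IsOracle Pr Y gx gy Gx Gy σ (ξ k)) {z₀ : Pt d d'} (h0 : z₀.2 ∈ Y) {A q : ℝ}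
    (hA0 : 17 / 16 * gap Y f z₀ ≤ A)
    (hA : ∀ k, 9 / 10 * (A * q ^ k) + 130 * η (k + 1) * σ ^ 2 ≤ A * q ^ (k + 1)) (k : ℕ) :
    Integrable (fun ω => gap Y f (pes Y Gx Gy γ η T (fun k t => ξ k t ω) z₀ k)) Pr ∧
    ∫ ω, gap Y f (pes Y Gx Gy γ η T (fun k t => ξ k t ω) z₀ k) ∂Pr
      ≤ 48 * (μ / μx + 1) * (A * q ^ k) := by
  obtain ⟨a1, a2, a3, a4⟩ := H.pes_potential hlam hγ hμy hη hηℓ hT hξ hind hO h0 hA0 hA k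
  set Z : Ω → Pt d d' := fun ω => pes Y Gx Gy γ η T (fun k t => ξ k t ω) z₀ k with hZ
  have hm : Measurable Z := a2.mono ((isSampleStream_past hξ hind (k + 1)).le 0) le_rfl
  have i1 := H.integrable_gap hm a3 a1
  have i2 := H.integrable_proxGap hm a3 a1 hm a3
  refine ⟨i1, ?_⟩
  have h1 := integral_mono i1 (i2.const_mul (3 + 2 * (γ / μx))) fun ω => H.gap_le_proxGap (a1 ω)
  rw [integral_const_mul] at h1
  have h2 := H.integral_proxGap_le_potential (Pr := Pr) Z
  have hμx := H.μx_pos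
  have hμ := H.μ_pos
  have h3 : 3 + 2 * (γ / μx) ≤ 3 * (μ / μx + 1) := by
    have h5 : 4 * (γ / μx) ≤ μ / μx := by
      rw [← mul_div_assoc]
      exact div_le_div_of_nonneg_right H.γ_le_μ hμx.le
    have : 0 < μ / μx := by positivity
    linarith
  have h4 : 0 ≤ ∫ ω, proxGap Y f γ (Z ω).1 (Z ω) ∂Pr :=
    integral_nonneg fun ω => H.proxGap_nonneg _ (a1 ω)
  calc ∫ ω, gap Y f (Z ω) ∂Pr
      ≤ (3 + 2 * (γ / μx)) * ∫ ω, proxGap Y f γ (Z ω).1 (Z ω) ∂Pr := h1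
    _ ≤ 3 * (μ / μx + 1) * (16 * (A * q ^ k)) :=
        mul_le_mul h3 (by linarith) h4 (by positivity)
    _ = 48 * (μ / μx + 1) * (A * q ^ k) := by ring

end RegularGame

/-! ### Step sizes and the number of epochs -/

theorem stepSize_succ (η₀ : ℝ) (k : ℕ) : stepSize η₀ (k + 1) = η₀ * Real.exp (-(1 / 16)) ^ k := by
  rw [stepSize, ← Real.exp_nat_mul]
  congr 2
  push_cast
  ring

/-- The decay of the step size and the growth of the length cancel, so every epoch has the same
contraction factor. -/
theorem le_stepSize_mul_epochLength {η₀ μ μy : ℝ} (hη₀ : 0 < η₀) (hlam : 0 < min (μ / 8) μy)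
    (k : ℕ) : 384 ≤ min (μ / 8) μy * (stepSize η₀ (k + 1) * epochLength η₀ μ μy (k + 1)) := by
  have h1 : 384 / (η₀ * min (μ / 8) μy) * Real.exp (((k + 1 : ℕ) - 1) / 16)
      ≤ (epochLength η₀ μ μy (k + 1) : ℝ) := Nat.le_ceil _
  have hpos : 0 < stepSize η₀ (k + 1) := by unfold stepSize; positivity
  have h2 := mul_le_mul_of_nonneg_left h1 (mul_pos hlam hpos).le
  have h3 : Real.exp (-((k + 1 : ℕ) - 1) / 16) * Real.exp (((k + 1 : ℕ) - 1) / 16) = 1 := by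
    rw [← Real.exp_add, ← Real.exp_zero]; congr 1; ring
  have h4 : min (μ / 8) μy * stepSize η₀ (k + 1)
      * (384 / (η₀ * min (μ / 8) μy) * Real.exp (((k + 1 : ℕ) - 1) / 16)) = 384 := by
    unfold stepSize
    calc _ = 384 * (η₀ * min (μ / 8) μy / (η₀ * min (μ / 8) μy))
          * (Real.exp (-((k + 1 : ℕ) - 1) / 16) * Real.exp (((k + 1 : ℕ) - 1) / 16)) := by ring
      _ = 384 := by rw [h3, div_self (mul_pos hη₀ hlam).ne']; ring
  linarith

/-- The factor 16 comes from `e^{1/16} - 1 ≥ 1/16`. -/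
theorem sum_exp_le (K : ℕ) :
    ∑ k ∈ Finset.range K, Real.exp ((k : ℝ) / 16) ≤ 16 * Real.exp ((K : ℝ) / 16) := by
  induction K with
  | zero => simp
  | succ K ih =>
    rw [Finset.sum_range_succ]
    have h1 : Real.exp (((K + 1 : ℕ) : ℝ) / 16) = Real.exp ((K : ℝ) / 16) * Real.exp (1 / 16) := by
      rw [← Real.exp_add]; congr 1; push_cast; ring
    have h2 := Real.add_one_le_exp (1 / 16 : ℝ)
    rw [h1]
    nlinarith [Real.exp_pos ((K : ℝ) / 16)]

/-- `6145 = 384·16 + 1`: the rounding is absorbed because `ℓ / min (μ/8) μy ≥ 1`. Then `98320 =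
16·6145`. -/
theorem sum_epochLength_le {ℓ μ μy : ℝ} (hlam : 0 < min (μ / 8) μy) (hℓ : min (μ / 8) μy ≤ ℓ)
    (K : ℕ) : ((∑ k ∈ Finset.Icc 1 K, epochLength (1 / 16 / ℓ) μ μy k : ℕ) : ℝ)
      ≤ 98320 * (ℓ / min (μ / 8) μy) * Real.exp ((K : ℝ) / 16) := by
  have hℓ0 : 0 < ℓ := hlam.trans_le hℓ
  have h1 : 1 ≤ ℓ / min (μ / 8) μy := (one_le_div hlam).2 hℓ
  have hterm : ∀ k ∈ Finset.range K, (epochLength (1 / 16 / ℓ) μ μy (k + 1) : ℝ)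
      ≤ 6145 * (ℓ / min (μ / 8) μy) * Real.exp ((k : ℝ) / 16) := by
    intro k _
    have h2 : (epochLength (1 / 16 / ℓ) μ μy (k + 1) : ℝ)
        ≤ 384 / (1 / 16 / ℓ * min (μ / 8) μy) * Real.exp (((k + 1 : ℕ) - 1) / 16) + 1 :=
      (Nat.ceil_lt_add_one (by positivity)).le
    have h3 : 384 / (1 / 16 / ℓ * min (μ / 8) μy) = 6144 * (ℓ / min (μ / 8) μy) := by
      field_simp; norm_num
    have h4 : ((k + 1 : ℕ) : ℝ) - 1 = k := by push_cast; ring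
    rw [h3, h4] at h2
    have h5 : 1 ≤ Real.exp ((k : ℝ) / 16) := Real.one_le_exp (by positivity)
    have h6 : 1 ≤ ℓ / min (μ / 8) μy * Real.exp ((k : ℝ) / 16) := one_le_mul_of_one_le_of_one_le h1 h5
    linarith
  push_cast
  rw [sum_Icc_one_eq]
  refine (Finset.sum_le_sum hterm).trans ?_
  rw [← Finset.mul_sum]
  have h2 := mul_le_mul_of_nonneg_left (sum_exp_le K)
    (show 0 ≤ 6145 * (ℓ / min (μ / 8) μy) by positivity)
  linarith

end PES

/-! ### Choice of the constants and of the number of epochs -/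

theorem corollary2 :
    -- universal constants: the step-size constant `c` and those of the soft-O bound
    ∃ (c C : ℝ) (p : ℕ), 0 < c ∧ c ≤ 1 / (2 * √2) ∧
    ∀ ℓ μ μx μy ε₀ σ ε : ℝ, 0 < ℓ → 0 < μ → 0 < μx → 0 < μy → 0 ≤ ε₀ → 0 < σ → 0 < ε →
    -- the number of epochs depends on the problem parameters only
    ∃ K : ℕ,
      ((∑ k ∈ Finset.Icc 1 K, PES.epochLength (c / ℓ) μ μy k : ℕ) : ℝ)
        ≤ C * PES.rate ℓ μ μx μy ε₀ σ ε
            * Real.log (2 + PES.rate ℓ μ μx μy ε₀ σ ε) ^ p ∧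
      ∀ (d d' : ℕ) (Y : Set (PES.Vec d')) (f : PES.Vec d → PES.Vec d' → ℝ)
        (gx : PES.Vec d → PES.Vec d' → PES.Vec d) (gy : PES.Vec d → PES.Vec d' → PES.Vec d')
        (z₀ : PES.Pt d d') (L ρ : ℝ)
        (Ω Ξ : Type*) [MeasurableSpace Ω] [MeasurableSpace Ξ]
        (Pr : MeasureTheory.Measure Ω) [MeasureTheory.IsProbabilityMeasure Pr]
        (ξ : ℕ → ℕ → Ω → Ξ)
        (Gx : PES.Vec d → PES.Vec d' → Ξ → PES.Vec d)
        (Gy : PES.Vec d → PES.Vec d' → Ξ → PES.Vec d'),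
        -- the objective on `ℝᵈ × Y`
        IsClosed Y → Convex ℝ Y →
        PES.IsPartialGradients Y f gx gy →
        PES.IsLipschitzField ℓ Y gx gy →
        (∀ x, StrongConcaveOn Y μy (fun y => f x y)) →
        -- the primal function: smooth, with a minimizer, and `μ`-PL
        PES.IsSmooth L (PES.primal Y f) →
        PES.IsPL μ (PES.primal Y f) (gradient (PES.primal Y f)) →
        -- the `x`-side `μx`-PL condition
        (∀ y ∈ Y, PES.IsPL μx (fun x => f x y) (fun x => gx x y)) →
        -- weak convexity in `x`
        0 < ρ → ρ ≤ ℓ → ρ ≤ μ / 8 →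
        (∀ y ∈ Y, PES.IsWeaklyConvex ρ (fun x => f x y) (fun x => gx x y)) →
        -- the starting point
        z₀.2 ∈ Y → PES.gap Y f z₀ ≤ ε₀ →
        -- the stochastic gradient oracle and the independent samples
        Measurable (fun q : PES.Pt d d' × Ξ => Gx q.1.1 q.1.2 q.2) →
        Measurable (fun q : PES.Pt d d' × Ξ => Gy q.1.1 q.1.2 q.2) →
        (∀ k t, Measurable (ξ k t)) →
        ProbabilityTheory.iIndepFun (fun q : ℕ × ℕ => ξ q.1 q.2) Pr →
        (∀ k t x, ∀ y ∈ Y,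
          PES.IsUnbiasedWithVariance Pr (ξ k t) (Gx x y) (gx x y) σ ∧
          PES.IsUnbiasedWithVariance Pr (ξ k t) (Gy x y) (gy x y) σ) →
        -- the expected duality gap after `K` epochs
        MeasureTheory.Integrable (fun ω => PES.gap Y f
          (PES.pes Y Gx Gy (min (μ / 4) (2 * ℓ)) (PES.stepSize (c / ℓ))
            (PES.epochLength (c / ℓ) μ μy) (fun k t => ξ k t ω) z₀ K)) Pr ∧
        ∫ ω, PES.gap Y f
          (PES.pes Y Gx Gy (min (μ / 4) (2 * ℓ)) (PES.stepSize (c / ℓ))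
            (PES.epochLength (c / ℓ) μ μy) (fun k t => ξ k t ω) z₀ K) ∂Pr ≤ ε := by
  -- `c = 1/16` gives `240c² ≤ 1`. The constant `C` exceeds `98320·8·28800`, and the exponent 0
  -- means that no logarithm is needed.
  refine ⟨1 / 16, 23000000000, 0, by norm_num, ?_, ?_⟩
  · rw [div_le_div_iff₀ (by norm_num) (by positivity)]
    have : √2 ≤ 2 := Real.sqrt_le_iff.2 (by norm_num)
    linarith
  intro ℓ μ μx μy ε₀ σ ε hℓ hμ hμx hμy hε₀ hσ hε
  have hlam : 0 < min (μ / 8) μy := lt_min (by positivity) hμy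
  have game : ∀ (d d' : ℕ) (Y : Set (PES.Vec d')) (f : PES.Vec d → PES.Vec d' → ℝ)
      (gx : PES.Vec d → PES.Vec d' → PES.Vec d) (gy : PES.Vec d → PES.Vec d' → PES.Vec d')
      (z₀ : PES.Pt d d') (L ρ : ℝ), IsClosed Y → Convex ℝ Y → PES.IsPartialGradients Y f gx gy →
      PES.IsLipschitzField ℓ Y gx gy → (∀ x, StrongConcaveOn Y μy (fun y => f x y)) →
      PES.IsSmooth L (PES.primal Y f) →
      PES.IsPL μ (PES.primal Y f) (gradient (PES.primal Y f)) →
      (∀ y ∈ Y, PES.IsPL μx (fun x => f x y) (fun x => gx x y)) → 0 < ρ → ρ ≤ ℓ → ρ ≤ μ / 8 →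
      (∀ y ∈ Y, PES.IsWeaklyConvex ρ (fun x => f x y) (fun x => gx x y)) → z₀.2 ∈ Y →
      PES.RegularGame ℓ μ μx μy L ρ (min (μ / 4) (2 * ℓ)) Y f gx gy := by
    intro d d' Y f gx gy z₀ L ρ h1 h2 h3 h4 h5 h6 h7 h8 hρ hρℓ hρμ h9 h10
    exact ⟨h1, h2, ⟨_, h10⟩, h3, h4, h5, h6, h7, h8, h9, hℓ, hμ, hμx, hμy, hρ,
      lt_min (by positivity) (by positivity), le_min (by linarith) (by linarith),
      by linarith [min_le_left (μ / 4) (2 * ℓ)], min_le_right _ _⟩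
  have hrate : PES.rate ℓ μ μx μy ε₀ σ ε
      = ℓ / min μ μy * ((μ / μx + 1) * (max (ℓ * ε₀) (σ ^ 2) / ℓ) / ε) := by
    unfold PES.rate
    have : 0 < min μ μy := lt_min hμ hμy
    field_simp
  have hmin : 0 < min μ μy := lt_min hμ hμy
  set B := max (ℓ * ε₀) (σ ^ 2) / ℓ with hB
  have hBε : ε₀ ≤ B := by rw [hB, le_div_iff₀ hℓ, mul_comm]; exact le_max_left _ _
  have hBσ : σ ^ 2 / ℓ ≤ B := div_le_div_of_nonneg_right (le_max_right _ _) hℓ.le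
  have hB0 : 0 ≤ B := hε₀.trans hBε
  -- In both cases `K = 0` works. Otherwise `E ≥ 1` makes the logarithm nonnegative, and `min (μ/8)
  -- μy ≤ ℓ` is needed for the rounding of `T_k` and for `λ ≤ γ/2`.
  by_cases htriv : ε₀ ≤ ε ∨ ℓ < min (μ / 8) μy
  · refine ⟨0, ?_, ?_⟩
    · rw [pow_zero, mul_one, hrate]
      simp only [Finset.Icc_eq_empty_of_lt zero_lt_one, Finset.sum_empty, Nat.cast_zero]
      positivity
    · intro d d' Y f gx gy z₀ L ρ Ω Ξ _ _ Pr _ ξ Gx Gy h1 h2 h3 h4 h5 h6 h7 h8 hρ hρℓ hρμ h9 h10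
        hgap _ _ _ _ _
      have H := game d d' Y f gx gy z₀ L ρ h1 h2 h3 h4 h5 h6 h7 h8 hρ hρℓ hρμ h9 h10
      have hle : PES.gap Y f z₀ ≤ ε := by
        rcases htriv with h | h
        · exact hgap.trans h
        · exact (PES.gap_nonpos_of_small_lipschitz H hρℓ (h.trans_le (min_le_left _ _))
            (h.trans_le (min_le_right _ _)) h10).trans hε.le
      simpa only [PES.pes, MeasureTheory.integral_const, MeasureTheory.probReal_univ, one_smul]
        using And.intro (MeasureTheory.integrable_const (μ := Pr) (PES.gap Y f z₀)) hle
  push Not at htriv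
  obtain ⟨hεε, hlamℓ⟩ := htriv
  set E := (μ / μx + 1) * B / ε with hE
  have hκ : 1 ≤ μ / μx + 1 := by linarith [div_pos hμ hμx]
  have hE1 : 1 ≤ E := by
    rw [hE, one_le_div hε]
    exact (hεε.le.trans hBε).trans (le_mul_of_one_le_left hB0 hκ)
  -- The gap bound after `K` epochs is `14400 E ε e^{-K/16}`, where `14400 = 48·300`.
  set K := ⌈16 * Real.log (14400 * E)⌉₊ with hK
  have hlog : 0 ≤ 16 * Real.log (14400 * E) := by
    have := Real.log_nonneg (show 1 ≤ 14400 * E by linarith)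
    linarith
  have hexplog : Real.exp (Real.log (14400 * E)) = 14400 * E := Real.exp_log (by linarith)
  have hKlow : 14400 * E ≤ Real.exp ((K : ℝ) / 16) := by
    rw [← hexplog]
    have : 16 * Real.log (14400 * E) ≤ (K : ℝ) := Nat.le_ceil _
    exact Real.exp_le_exp.2 (by linarith)
  have hdec : 15 / 16 ≤ Real.exp (-(1 / 16)) := by
    have := Real.add_one_le_exp (-(1 / 16) : ℝ)
    linarith
  have hinv : Real.exp (1 / 16) ≤ 2 := by
    have h1 : Real.exp (1 / 16) * Real.exp (-(1 / 16)) = 1 := by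
      rw [← Real.exp_add, add_neg_cancel, Real.exp_zero]
    nlinarith [Real.exp_pos (1 / 16)]
  have hKup : Real.exp ((K : ℝ) / 16) ≤ 28800 * E := by
    have h1 : (K : ℝ) < 16 * Real.log (14400 * E) + 1 := Nat.ceil_lt_add_one hlog
    calc Real.exp ((K : ℝ) / 16) ≤ Real.exp (Real.log (14400 * E) + 1 / 16) :=
          Real.exp_le_exp.2 (by linarith)
      _ = 14400 * E * Real.exp (1 / 16) := by rw [Real.exp_add, hexplog]
      _ ≤ 14400 * E * 2 := by gcongr
      _ = 28800 * E := by ring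
  refine ⟨K, ?_, ?_⟩
  · have h1 := PES.sum_epochLength_le hlam hlamℓ K
    have h2 : ℓ / min (μ / 8) μy ≤ 8 * (ℓ / min μ μy) := by
      have h3 : min μ μy / 8 ≤ min (μ / 8) μy :=
        le_min (by linarith [min_le_left μ μy]) (by linarith [min_le_right μ μy])
      rw [← mul_div_assoc, div_le_div_iff₀ hlam hmin]
      nlinarith
    have h3 : ℓ / min (μ / 8) μy * Real.exp ((K : ℝ) / 16) ≤ 8 * (ℓ / min μ μy) * (28800 * E) :=
      mul_le_mul h2 hKup (Real.exp_pos _).le (by positivity)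
    have h4 : 0 ≤ ℓ / min μ μy * E := by positivity
    rw [pow_zero, mul_one, hrate]
    linarith
  · intro d d' Y f gx gy z₀ L ρ Ω Ξ _ _ Pr _ ξ Gx Gy h1 h2 h3 h4 h5 h6 h7 h8 hρ hρℓ hρμ h9 h10
      hgap hGx hGy hξ hind hunb
    have H := game d d' Y f gx gy z₀ L ρ h1 h2 h3 h4 h5 h6 h7 h8 hρ hρℓ hρμ h9 h10
    have hγ : min (μ / 8) μy ≤ min (μ / 4) (2 * ℓ) / 2 := by
      rw [le_div_iff₀ two_pos]
      exact le_min (by linarith [min_le_left (μ / 8) μy]) (by linarith)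
    have hη : ∀ k, 0 < PES.stepSize (1 / 16 / ℓ) k := fun k => by
      unfold PES.stepSize; positivity
    have hηℓ : ∀ k, 240 * (PES.stepSize (1 / 16 / ℓ) (k + 1) ^ 2 * ℓ ^ 2) ≤ 1 := by
      intro k
      have h11 : Real.exp (-(1 / 16)) ^ k ≤ 1 :=
        pow_le_one₀ (Real.exp_pos _).le (Real.exp_le_one_iff.2 (by norm_num))
      have h12 : PES.stepSize (1 / 16 / ℓ) (k + 1) * ℓ ≤ 1 / 16 := by
        rw [PES.stepSize_succ]
        have e : 1 / 16 / ℓ * Real.exp (-(1 / 16)) ^ k * ℓ = 1 / 16 * Real.exp (-(1 / 16)) ^ k := by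
          field_simp
        rw [e]
        linarith
      have h13 := pow_le_pow_left₀ (mul_pos (hη (k + 1)) hℓ).le h12 2
      rw [mul_pow] at h13
      linarith
    -- With `A = 300B` and `e^{-1/16} ≥ 15/16`, this reduces to `270 + 130/16 ≤ 300·15/16`.
    have hstep : ∀ k, 9 / 10 * (300 * B * Real.exp (-(1 / 16)) ^ k)
        + 130 * PES.stepSize (1 / 16 / ℓ) (k + 1) * σ ^ 2
          ≤ 300 * B * Real.exp (-(1 / 16)) ^ (k + 1) := by
      intro k
      rw [PES.stepSize_succ, pow_succ (Real.exp (-(1 / 16)))]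
      have hq : 0 < Real.exp (-(1 / 16)) ^ k := by positivity
      have e : 130 * (1 / 16 / ℓ * Real.exp (-(1 / 16)) ^ k) * σ ^ 2
          = 130 / 16 * (σ ^ 2 / ℓ) * Real.exp (-(1 / 16)) ^ k := by ring
      rw [e]
      have h11 := mul_le_mul_of_nonneg_left hdec (mul_nonneg hB0 hq.le)
      have h12 := mul_le_mul_of_nonneg_right hBσ hq.le
      have h13 := mul_nonneg hB0 hq.le
      linarith
    have hO : ∀ k, PES.IsOracle Pr Y gx gy Gx Gy σ (ξ k) := fun k => ⟨hGx, hGy, hunb k⟩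
    obtain ⟨hint, hbound⟩ := H.pes_gap hlam hγ (min_le_right _ _) hη hηℓ
      (PES.le_stepSize_mul_epochLength (by positivity) hlam) hξ hind hO h10
      (show 17 / 16 * PES.gap Y f z₀ ≤ 300 * B by linarith) hstep K
    refine ⟨hint, hbound.trans ?_⟩
    have e1 : Real.exp (-(1 / 16)) ^ K = (Real.exp ((K : ℝ) / 16))⁻¹ := by
      rw [← Real.exp_nat_mul, ← Real.exp_neg]; congr 1; ring
    have e2 : 48 * (μ / μx + 1) * (300 * B * (Real.exp ((K : ℝ) / 16))⁻¹)
        = 14400 * E * ε / Real.exp ((K : ℝ) / 16) := by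
      rw [hE]; field_simp; ring
    rw [e1, e2, div_le_iff₀ (Real.exp_pos _), mul_comm ε]
    exact mul_le_mul_of_nonneg_right hKlow hε.le
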